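/- Let $\mathbb R^{3,1}$ be $\mathbb R^4$ with $\langle x,y\rangle=-x_0y_0+x_1y_1+x_2y_2+x_3y_3$. Extended hyperbolic 3-space is the projective space $\mathbb P(\mathbb R^{3,1})$; it contains the affine chart $\mathbb K^3=\{[1:x]:x\in\mathbb R^3\}\cong\mathbb R^3$, in which hyperbolic space $\mathbb H^3$ is the open unit ball and $\partial\mathbb H^3$ is the unit sphere. A hyperbolic isometry is the projective map induced by a linear automorphism $g\in O(3,1)$. For $\epsilon>0$ put $d_\epsilon=1-\epsilon i$ and $$dV_\epsilon=\frac{d_\epsilon\,dx_1\,dx_2\,dx_3}{(d_\epsilon^2-|x|^2)^2}\quad\text{on }\mathbb K^3,\qquad \mu(U)=\lim_{\epsilon\to0^+}\int_{U\cap\mathbb K^3}dV_\epsilon\in\mathbb C$$ whenever the integrals converge absolutely and the limit exists in $\mathbb C$. Let $0<\alpha\le1$. A set $U\subset\mathbb P(\mathbb R^{3,1})$ is called $C^{1,\alpha}$-transversal to $\partial\mathbb H^3$ if for each point $p\in\partial\mathbb H^3$ of the topological boundary $\partial U$ there are an open neighbourhood $V\subset\mathbb K^3$ of $p$ and a function $f\in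 C^{1,\alpha}(V)$ (that is, $f$ is $C^1$ and $df$ is $\alpha$-Hölder on $V$) with $\partial U\cap V=\{x\in V: f(x)=0\}$, such that at each $q\in V\cap\partial\mathbb H^3$ with $f(q)=0$ the zero set of $f$ is regular and transversal to $\partial\mathbb H^3$, i.e. $df_q$ does not vanish identically on the tangent plane $T_q\partial\mathbb H^3$. **Theorem.** Let $U\subset\mathbb P(\mathbb R^{3,1})$ be a $C^{1,\alpha}$-transversal domain (or, more generally, a $C^{1,\alpha}$-transversal set for which $U\cap\mathbb K^3$ is Borel), and let $g\in O(3,1)$. Then the volumes $\mu(U)$ and $\mu(gU)$ exist as finite complex numbers and $$\mu(gU)=\mu(U).$$ -/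

import Mathlib

open Set Filter Topology MeasureTheory
open scoped NNReal LinearAlgebra.Projectivization

noncomputable section

namespace ExtendedHyperbolic

/-- The affine space `𝕂³`, i.e. `ℝ³` with its Euclidean structure and Lebesgue measure. -/
abbrev K3 : Type := EuclideanSpace ℝ (Fin 3)

/-- The vector space underlying Minkowski space `ℝ^{3,1}`; the first factor is the time
coordinate `x₀`, the second one is `(x₁, x₂, x₃)`. -/
abbrev Minkowski : Type := ℝ × K3

/-- The Lorentz inner product `⟨x, y⟩ = -x₀ y₀ + x₁ y₁ + x₂ y₂ + x₃ y₃`. -/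
def lorentzInner (x y : Minkowski) : ℝ := -(x.1 * y.1) + inner ℝ x.2 y.2

/-- A hyperbolic isometry, in its linear form: an element of the Lorentz group `O(3,1)`. -/
def IsLorentz (g : Minkowski ≃ₗ[ℝ] Minkowski) : Prop :=
  ∀ x y : Minkowski, lorentzInner (g x) (g y) = lorentzInner x y

/-- Extended hyperbolic space: the projectivization of Minkowski space. -/
abbrev ExtSpace : Type := ℙ ℝ Minkowski

/-- The inclusion of `𝕂³ = {1} × ℝ³` in extended hyperbolic space, `x ↦ [1 : x]`. -/
def ofK3 (x : K3) : ExtSpace :=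
  Projectivization.mk ℝ ((1, x) : Minkowski) (fun h => one_ne_zero (congrArg Prod.fst h))

/-- The part of `U` that lies in the affine chart `𝕂³`. It omits only points of the plane at
infinity, which is disjoint from the closed ball and has measure zero. -/
def affinePart (U : Set ExtSpace) : Set K3 := ofK3 ⁻¹' U

/-- The action of a linear automorphism on subsets of extended hyperbolic space. -/
def act (g : Minkowski ≃ₗ[ℝ] Minkowski) (U : Set ExtSpace) : Set ExtSpace :=
  Projectivization.map (g : Minkowski →ₗ[ℝ] Minkowski) g.injective '' U

/-- The boundary `∂ℍ³` of hyperbolic space: the unit sphere of `𝕂³`. -/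
def boundaryH : Set K3 := Metric.sphere 0 1

/-- `f` is of class `C^{1,α}` on the set `V` (used for open `V`). -/
def IsC1Holder (α : ℝ≥0) (f : K3 → ℝ) (V : Set K3) : Prop :=
  ContDiffOn ℝ 1 f V ∧ ∃ C : ℝ≥0, HolderOnWith C α (fderiv ℝ f) V

/-- The zero set of `f` is a regular surface transversal to the unit sphere at the point `q` of
the sphere: some vector `v` tangent to the sphere at `q` is not annihilated by `df_q`. Equivalently,
`df_q ≠ 0` and the planes `ker df_q` and `q^⊥` together span `ℝ³`. -/
def IsTransversalAt (f : K3 → ℝ) (q : K3) : Prop :=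
  ∃ v : K3, inner ℝ q v = 0 ∧ fderiv ℝ f q v ≠ 0

/-- A subset `D` of `𝕂³` is `C^{1,α}`-transversal to `∂ℍ³`: near each point of `∂D ∩ ∂ℍ³` the
topological boundary `∂D` is the zero set of one `C^{1,α}` function transversal to `∂ℍ³`. -/
def IsC1HolderTransversal (α : ℝ≥0) (D : Set K3) : Prop :=
  ∀ p ∈ frontier D ∩ boundaryH, ∃ V : Set K3, IsOpen V ∧ p ∈ V ∧ ∃ f : K3 → ℝ,
    IsC1Holder α f V ∧ frontier D ∩ V = {x | x ∈ V ∧ f x = 0} ∧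
      ∀ q ∈ V ∩ boundaryH, f q = 0 → IsTransversalAt f q

/-- `d_ε = 1 - ε i`. -/
def dEps (ε : ℝ) : ℂ := 1 - (ε : ℂ) * Complex.I

/-- The density of the complex volume form `dV_ε = d_ε dx₁ dx₂ dx₃ / (d_ε² - |x|²)²`. In dimension
three the exponent `(n + 1) / 2` is the integer `2`, so that no branch has to be chosen. -/
def volDensity (ε : ℝ) (x : K3) : ℂ := dEps ε / (dEps ε ^ 2 - ((‖x‖ ^ 2 : ℝ) : ℂ)) ^ 2

/-- The volume of `U` exists (as a finite complex number) and equals `v`: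
`μ(U) = lim_{ε → 0+} ∫_U dV_ε = v`, where the integrals converge absolutely. -/
def HasVolume (U : Set ExtSpace) (v : ℂ) : Prop :=
  (∀ ε : ℝ, 0 < ε → IntegrableOn (volDensity ε) (affinePart U) volume) ∧
    Tendsto (fun ε : ℝ => ∫ x in affinePart U, volDensity ε x) (𝓝[>] 0) (𝓝 v)

end ExtendedHyperbolic

end

noncomputable section

namespace ExtendedHyperbolic

open scoped ContDiff Manifold

/-! ### The pulled-back volume form: size, integrability, limit -/

section

/-! Let ℓ(x) be the time coordinate of g(1, x). The projective map of g has Jacobian ±ℓ⁻⁴, so it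
pulls dV_ε back to d_ε dx / P², and for Lorentz g one has P = (1 - |x|²) - (2iε + ε²) ℓ². Thus g
only changes the way in which the singular form dx / (1 - |x|²)² is regularised, and Im P ≤ 0 for
every g. It suffices that the limit of ∫_U d_ε / P² exists and is the same for all g;
`HasInvariantLimit` expresses this for a weight in place of the indicator of U.

Since |1 - |x|²| ≤ |P|, dominated convergence settles every bounded measurable weight ψ with |ψ| /
(1 - |x|²)² integrable (`HasInvariantLimit.of_integrable`), in particular everything away from the
sphere. A partition of unity leaves small neighbourhoods of points of the sphere.

There, consider first a smooth cutoff χ restricted to a set that is a union of parallel lines in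
each plane of a family, all transversal to the sphere. Two integrations by parts along each line
turn χ / P² into a bounded kernel times log(iP), with no boundary terms. As iP stays in the right
half-plane, the principal logarithm is dominated by an integrable function and tends to log(i(1 -
|x|²)) whatever g is (`hasInvariantLimit_shearWeight`).

In general, slice by the planes t = const. Each meets the curve ∂U ∩ ∂ℍ³ near p in one point γ(t);
replace the slice of ∂U by its tangent line at γ(t), whose direction e₂ + b(t) e₁ is transversal to
the sphere. By the Hölder condition, the error lies in a cusp |θ| ≤ K |d|^(1+α), where d is the
difference of the e₂-coordinates of x and γ(t), and there |1 - |x|²| ≥ |d|. So (1 - |x|²)⁻² is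
integrable over the cusp because |d|^(α-1) is integrable (`isLocallyInvariant_of_mem_frontier`).
Nothing is differentiated across the slices, so b need only be measurable and bounded. -/

/-- The square-rooted denominator of the pull-back of `dV_ε` under the projective map of `g`. -/
def denom (g : Minkowski ≃ₗ[ℝ] Minkowski) (ε : ℝ) (x : K3) : ℂ :=
  dEps ε ^ 2 * ((g (1, x)).1 : ℂ) ^ 2 - ((‖(g (1, x)).2‖ ^ 2 : ℝ) : ℂ)

/-- The density of the pull-back of `dV_ε` under the projective map of `g`. -/
def pullDensity (g : Minkowski ≃ₗ[ℝ] Minkowski) (ε : ℝ) (x : K3) : ℂ :=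
  dEps ε / denom g ε x ^ 2

theorem pullDensity_refl (ε : ℝ) (x : K3) :
    pullDensity (LinearEquiv.refl ℝ Minkowski) ε x = volDensity ε x := by
  simp [pullDensity, denom, volDensity]

theorem IsLorentz.refl : IsLorentz (LinearEquiv.refl ℝ Minkowski) := fun _ _ => rfl

variable {g : Minkowski ≃ₗ[ℝ] Minkowski}

theorem IsLorentz.sq_sub_sq (hg : IsLorentz g) (x : K3) :
    (g (1, x)).1 ^ 2 - ‖(g (1, x)).2‖ ^ 2 = 1 - ‖x‖ ^ 2 := by
  have := hg (1, x) (1, x)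
  simp only [lorentzInner, real_inner_self_eq_norm_sq] at this
  linarith

theorem IsLorentz.denom_eq (hg : IsLorentz g) (ε : ℝ) (x : K3) :
    denom g ε x = ((1 - ‖x‖ ^ 2 : ℝ) : ℂ)
      - (2 * ε * Complex.I + ε ^ 2) * ((g (1, x)).1 : ℂ) ^ 2 := by
  rw [← hg.sq_sub_sq x, denom, dEps]
  push_cast
  linear_combination (ε : ℂ) ^ 2 * ((g (1, x)).1 : ℂ) ^ 2 * Complex.I_sq

theorem denom_re (g : Minkowski ≃ₗ[ℝ] Minkowski) (ε : ℝ) (x : K3) :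
    (denom g ε x).re = (1 - ε ^ 2) * (g (1, x)).1 ^ 2 - ‖(g (1, x)).2‖ ^ 2 := by
  simp only [denom, dEps, ← Complex.ofReal_pow]
  simp [pow_two]

theorem denom_im (g : Minkowski ≃ₗ[ℝ] Minkowski) (ε : ℝ) (x : K3) :
    (denom g ε x).im = -(2 * ε * (g (1, x)).1 ^ 2) := by
  simp only [denom, dEps, ← Complex.ofReal_pow]
  simp [pow_two]
  ring

/-- The denominator factors as (d_ε a - b)(d_ε a + b), and Re d_ε = 1, so the factors have real
parts a - b and a + b. The bound is uniform in ε and in g, and underlies every dominated convergence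
below. -/
theorem IsLorentz.abs_le_norm_denom (hg : IsLorentz g) (ε : ℝ) (x : K3) :
    |1 - ‖x‖ ^ 2| ≤ ‖denom g ε x‖ := by
  rw [← hg.sq_sub_sq x]
  set a := (g (1, x)).1
  set b := ‖(g (1, x)).2‖
  have h1 : denom g ε x = (dEps ε * a - b) * (dEps ε * a + b) := by
    simp only [denom]; push_cast; ring
  have h2 : a ^ 2 - b ^ 2 = (a - b) * (a + b) := by ring
  rw [h1, h2, norm_mul, abs_mul]
  gcongr
  · have := Complex.abs_re_le_norm (dEps ε * a - b)
    simpa [dEps] using this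
  · have := Complex.abs_re_le_norm (dEps ε * a + b)
    simpa [dEps] using this

theorem exists_le_norm_apply (g : Minkowski ≃ₗ[ℝ] Minkowski) :
    ∃ C : ℝ, 0 < C ∧ ∀ x : K3, 1 + ‖x‖ ^ 2 ≤ C * ((g (1, x)).1 ^ 2 + ‖(g (1, x)).2‖ ^ 2) := by
  let G := g.symm.toContinuousLinearEquiv
  refine ⟨2 * ‖(G : Minkowski →L[ℝ] Minkowski)‖ ^ 2 + 1, by positivity, fun x => ?_⟩
  have h : ‖((1, x) : Minkowski)‖ ≤ ‖(G : Minkowski →L[ℝ] Minkowski)‖ * ‖g (1, x)‖ := by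
    have := (G : Minkowski →L[ℝ] Minkowski).le_opNorm (g (1, x))
    simpa [G] using this
  have h1 : ‖((1, x) : Minkowski)‖ = max 1 ‖x‖ := by simp [Prod.norm_def]
  have h2 : ‖g (1, x)‖ ^ 2 ≤ (g (1, x)).1 ^ 2 + ‖(g (1, x)).2‖ ^ 2 := by
    rw [Prod.norm_def, Real.norm_eq_abs]
    rcases max_cases |(g (1, x)).1| ‖(g (1, x)).2‖ with h | h <;> rw [h.1]
    · rw [sq_abs]; nlinarith [sq_nonneg ‖(g (1, x)).2‖]
    · nlinarith [sq_nonneg (g (1, x)).1]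
  rw [h1] at h
  have h3 : (1 : ℝ) ^ 2 ≤ (max 1 ‖x‖) ^ 2 := by gcongr; exact le_max_left _ _
  have h4 : ‖x‖ ^ 2 ≤ (max 1 ‖x‖) ^ 2 := by gcongr; exact le_max_right _ _
  have h5 : (max 1 ‖x‖) ^ 2 ≤ ‖(G : Minkowski →L[ℝ] Minkowski)‖ ^ 2 * ‖g (1, x)‖ ^ 2 := by
    rw [← mul_pow]; gcongr
  have h6 := mul_le_mul_of_nonneg_left h2 (sq_nonneg ‖(G : Minkowski →L[ℝ] Minkowski)‖)
  nlinarith [sq_nonneg ‖g (1, x)‖]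

/-- The imaginary part -2εℓ² controls ℓ², the real part then controls the space component, and
invertibility of g recovers 1 + |x|². The constant degenerates as ε → 0; it only serves absolute
convergence at fixed ε. -/
theorem exists_le_norm_denom (g : Minkowski ≃ₗ[ℝ] Minkowski) {ε : ℝ} (hε : 0 < ε) :
    ∃ c : ℝ, 0 < c ∧ ∀ x : K3, c * (1 + ‖x‖ ^ 2) ≤ ‖denom g ε x‖ := by
  obtain ⟨C, hC, h⟩ := exists_le_norm_apply g
  set K := 1 / (2 * ε) + (1 + |1 - ε ^ 2| * (1 / (2 * ε)))
  have hK : 0 < K := by positivity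
  refine ⟨1 / (C * K), by positivity, fun x => ?_⟩
  have hre := Complex.abs_re_le_norm (denom g ε x)
  have him := Complex.abs_im_le_norm (denom g ε x)
  rw [denom_re] at hre
  rw [denom_im, abs_neg, abs_of_nonneg (by positivity)] at him
  have h1 : (g (1, x)).1 ^ 2 ≤ 1 / (2 * ε) * ‖denom g ε x‖ := by
    rw [div_mul_eq_mul_div, le_div_iff₀ (by positivity)]; linarith
  have h2 : ‖(g (1, x)).2‖ ^ 2 ≤ (1 + |1 - ε ^ 2| * (1 / (2 * ε))) * ‖denom g ε x‖ := by
    have h3 := (abs_le.1 hre).1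
    have h4 : (1 - ε ^ 2) * (g (1, x)).1 ^ 2 ≤ |1 - ε ^ 2| * (1 / (2 * ε) * ‖denom g ε x‖) := by
      gcongr; exact le_abs_self _
    linarith
  have h3 : 1 + ‖x‖ ^ 2 ≤ C * (K * ‖denom g ε x‖) := by
    refine (h x).trans ?_
    gcongr
    simp only [K]; linarith
  rw [div_mul_eq_mul_div, div_le_iff₀ (by positivity)]
  linarith

theorem denom_ne_zero (g : Minkowski ≃ₗ[ℝ] Minkowski) {ε : ℝ} (hε : 0 < ε) (x : K3) :
    denom g ε x ≠ 0 := by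
  obtain ⟨c, hc, h⟩ := exists_le_norm_denom g hε
  have : 0 < ‖denom g ε x‖ := lt_of_lt_of_le (by positivity) (h x)
  simpa using this

@[fun_prop]
theorem continuous_apply_one (g : Minkowski ≃ₗ[ℝ] Minkowski) :
    Continuous fun x : K3 => g (1, x) :=
  g.toLinearMap.continuous_of_finiteDimensional.comp (by fun_prop)

@[fun_prop]
theorem continuous_denom (g : Minkowski ≃ₗ[ℝ] Minkowski) (ε : ℝ) : Continuous (denom g ε) := by
  have h1 := (continuous_apply_one g).fst
  have h2 := (continuous_apply_one g).snd
  unfold denom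
  fun_prop

theorem continuous_pullDensity (g : Minkowski ≃ₗ[ℝ] Minkowski) {ε : ℝ} (hε : 0 < ε) :
    Continuous (pullDensity g ε) := by
  have h := continuous_denom g ε
  exact continuous_const.div (h.pow 2) fun x => pow_ne_zero _ (denom_ne_zero g hε x)

/-- The density is O((1 + |x|²)⁻²), and the decay exponent 4 exceeds the dimension 3. -/
theorem integrable_pullDensity (g : Minkowski ≃ₗ[ℝ] Minkowski) {ε : ℝ} (hε : 0 < ε) :
    Integrable (pullDensity g ε) := by
  obtain ⟨c, hc, h⟩ := exists_le_norm_denom g hε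
  have h1 : Integrable (fun x : K3 => (1 + ‖x‖ ^ 2) ^ (-(4 : ℝ) / 2)) :=
    integrable_rpow_neg_one_add_norm_sq (by simp; norm_num)
  refine (h1.const_mul (‖dEps ε‖ / c ^ 2)).mono'
    (continuous_pullDensity g hε).aestronglyMeasurable (.of_forall fun x => ?_)
  have h2 : (1 + ‖x‖ ^ 2) ^ (-(4 : ℝ) / 2) = ((1 + ‖x‖ ^ 2) ^ 2)⁻¹ := by
    rw [show -(4 : ℝ) / 2 = -((2 : ℕ) : ℝ) by norm_num, Real.rpow_neg (by positivity),
      Real.rpow_natCast]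
  rw [h2, pullDensity, norm_div, norm_pow, ← div_eq_mul_inv, div_div, ← mul_pow]
  gcongr
  exact h x

theorem norm_dEps_le {ε : ℝ} (h0 : 0 ≤ ε) (h1 : ε ≤ 1) : ‖dEps ε‖ ≤ 2 := by
  unfold dEps
  refine (norm_sub_le _ _).trans ?_
  simp [abs_of_nonneg h0]
  linarith

theorem ae_norm_ne_one : ∀ᵐ x : K3, ‖x‖ ≠ 1 := by
  have : volume (Metric.sphere (0 : K3) 1) = 0 := Measure.addHaar_sphere _ _ _
  filter_upwards [compl_mem_ae_iff.2 this] with x hx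
  simpa using hx

theorem one_sub_sq_ne_zero {x : K3} (hx : ‖x‖ ≠ 1) : 1 - ‖x‖ ^ 2 ≠ 0 := by
  intro h
  apply hx
  have := norm_nonneg x
  nlinarith

theorem IsLorentz.tendsto_denom (hg : IsLorentz g) (x : K3) :
    Tendsto (fun ε => denom g ε x) (𝓝[>] 0) (𝓝 ((1 - ‖x‖ ^ 2 : ℝ) : ℂ)) := by
  have h : Continuous fun ε : ℝ => denom g ε x := by unfold denom dEps; fun_prop
  have := h.tendsto 0
  rw [hg.denom_eq 0] at this
  simpa using this.mono_left nhdsWithin_le_nhds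

theorem tendsto_dEps : Tendsto dEps (𝓝[>] 0) (𝓝 1) := by
  have h : Continuous dEps := by unfold dEps; fun_prop
  have := h.tendsto 0
  simp only [dEps, Complex.ofReal_zero, zero_mul, sub_zero] at this
  exact this.mono_left nhdsWithin_le_nhds

/-! ### Weights with a limit common to all Lorentz maps -/

/-- A bounded measurable weight whose integrals against all pulled-back forms have one common
limit as `ε → 0+`. -/
def HasInvariantLimit (ψ : K3 → ℝ) : Prop :=
  Measurable ψ ∧ (∃ C, ∀ x, |ψ x| ≤ C) ∧ ∃ v : ℂ, ∀ g, IsLorentz g →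
    Tendsto (fun ε : ℝ => ∫ x, (ψ x : ℂ) * pullDensity g ε x) (𝓝[>] 0) (𝓝 v)

theorem integrable_weight_mul {ψ : K3 → ℝ} (hm : Measurable ψ) {C : ℝ} (hC : ∀ x, |ψ x| ≤ C)
    (g : Minkowski ≃ₗ[ℝ] Minkowski) {ε : ℝ} (hε : 0 < ε) :
    Integrable fun x => (ψ x : ℂ) * pullDensity g ε x :=
  (integrable_pullDensity g hε).bdd_mul (c := C) (by fun_prop)
    (.of_forall fun x => by simpa using hC x)

theorem HasInvariantLimit.add {ψ φ : K3 → ℝ} (hψ : HasInvariantLimit ψ)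
    (hφ : HasInvariantLimit φ) : HasInvariantLimit fun x => ψ x + φ x := by
  obtain ⟨h1, ⟨C, hC⟩, v, hv⟩ := hψ
  obtain ⟨h1', ⟨C', hC'⟩, v', hv'⟩ := hφ
  refine ⟨h1.add h1', ⟨C + C', fun x => (abs_add_le _ _).trans (add_le_add (hC x) (hC' x))⟩,
    v + v', fun g hg => ((hv g hg).add (hv' g hg)).congr' ?_⟩
  filter_upwards [self_mem_nhdsWithin] with ε hε
  rw [← integral_add (integrable_weight_mul h1 hC g hε) (integrable_weight_mul h1' hC' g hε)]
  congr with x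
  push_cast
  ring

theorem HasInvariantLimit.sum {ι : Type*} (s : Finset ι) {ψ : ι → K3 → ℝ}
    (h : ∀ i ∈ s, HasInvariantLimit (ψ i)) : HasInvariantLimit fun x => ∑ i ∈ s, ψ i x := by
  classical
  induction s using Finset.induction_on with
  | empty => exact ⟨by simp, ⟨0, by simp⟩, 0, by simp⟩
  | insert i s hi ih =>
    simp only [Finset.sum_insert hi]
    exact (h i (by simp)).add (ih fun j hj => h j (by simp [hj]))

/-- Weights that vanish to the second order at the sphere, in the sense of integrability, are
handled by dominated convergence. -/
theorem HasInvariantLimit.of_integrable {ψ : K3 → ℝ} (hm : Measurable ψ)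
    (hC : ∃ C, ∀ x, |ψ x| ≤ C) (hi : Integrable fun x => |ψ x| / (1 - ‖x‖ ^ 2) ^ 2) :
    HasInvariantLimit ψ := by
  refine ⟨hm, hC, ∫ x, (ψ x : ℂ) * (1 / ((1 - ‖x‖ ^ 2 : ℝ) : ℂ) ^ 2), fun g hg => ?_⟩
  obtain ⟨C, hC⟩ := hC
  refine tendsto_integral_filter_of_dominated_convergence
    (fun x => 2 * (|ψ x| / (1 - ‖x‖ ^ 2) ^ 2)) ?_ ?_ (hi.const_mul 2) ?_
  · filter_upwards [self_mem_nhdsWithin] with ε hε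
    exact (integrable_weight_mul hm hC g hε).aestronglyMeasurable
  · filter_upwards [Ioc_mem_nhdsGT (zero_lt_one (α := ℝ))] with ε hε
    filter_upwards [ae_norm_ne_one] with x hx
    have h0 := one_sub_sq_ne_zero hx
    rw [norm_mul, pullDensity, norm_div, norm_pow, Complex.norm_real, Real.norm_eq_abs,
      mul_div_left_comm, div_eq_mul_inv, div_eq_mul_inv, mul_left_comm,
      ← sq_abs (1 - ‖x‖ ^ 2), mul_left_comm (2 : ℝ)]
    have h1 : 0 < |1 - ‖x‖ ^ 2| := abs_pos.2 h0
    gcongr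
    · exact norm_dEps_le hε.1.le hε.2
    · exact hg.abs_le_norm_denom ε x
  · filter_upwards [ae_norm_ne_one] with x hx
    have h0 := one_sub_sq_ne_zero hx
    refine Tendsto.const_mul _ (tendsto_dEps.div ((hg.tendsto_denom x).pow 2) ?_)
    exact pow_ne_zero _ (by exact_mod_cast h0)

end

/-! ### Change of variables under the projective map -/

section

/-- The standard basis of Minkowski space, with the time coordinate separated. -/
def minkowskiBasis : Module.Basis (Unit ⊕ Fin 3) ℝ Minkowski :=
  (Module.Basis.singleton Unit ℝ).prod (EuclideanSpace.basisFun (Fin 3) ℝ).toBasis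

/-- The linear map of Minkowski space with the blocks `a`, `β`, `c`, `A`. -/
def blockMap (a : ℝ) (β : K3 →ₗ[ℝ] ℝ) (c : K3) (A : K3 →ₗ[ℝ] K3) : Minkowski →ₗ[ℝ] Minkowski :=
  (a • LinearMap.fst ℝ ℝ K3 + β ∘ₗ LinearMap.snd ℝ ℝ K3).prod
    (LinearMap.toSpanSingleton ℝ K3 c ∘ₗ LinearMap.fst ℝ ℝ K3 + A ∘ₗ LinearMap.snd ℝ ℝ K3)

theorem blockMap_apply (a : ℝ) (β : K3 →ₗ[ℝ] ℝ) (c : K3) (A : K3 →ₗ[ℝ] K3) (v : Minkowski) :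
    blockMap a β c A v = (a * v.1 + β v.2, v.1 • c + A v.2) := rfl

theorem toMatrix_blockMap (a : ℝ) (β : K3 →ₗ[ℝ] ℝ) (c : K3) (A : K3 →ₗ[ℝ] K3) :
    LinearMap.toMatrix minkowskiBasis minkowskiBasis (blockMap a β c A) =
      Matrix.fromBlocks (Matrix.of fun _ _ => a)
        (Matrix.of fun _ j => β (EuclideanSpace.basisFun (Fin 3) ℝ j))
        (Matrix.of fun i _ => c i)
        (LinearMap.toMatrix (EuclideanSpace.basisFun (Fin 3) ℝ).toBasis
          (EuclideanSpace.basisFun (Fin 3) ℝ).toBasis A) := by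
  ext i j
  rcases i with i | i <;> rcases j with j | j <;>
    simp [LinearMap.toMatrix_apply, minkowskiBasis, blockMap_apply]

theorem det_blockMap_upper (a : ℝ) (β : K3 →ₗ[ℝ] ℝ) (A : K3 →ₗ[ℝ] K3) :
    LinearMap.det (blockMap a β 0 A) = a * LinearMap.det A := by
  rw [← LinearMap.det_toMatrix minkowskiBasis, toMatrix_blockMap,
    ← LinearMap.det_toMatrix (EuclideanSpace.basisFun (Fin 3) ℝ).toBasis A]
  have : (Matrix.of fun (i : Fin 3) (_ : Unit) => (0 : K3) i) = 0 := by ext; simp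
  rw [this, Matrix.det_fromBlocks_zero₂₁]
  simp

theorem det_blockMap_lower (c : K3) :
    LinearMap.det (blockMap 1 0 c LinearMap.id) = 1 := by
  rw [← LinearMap.det_toMatrix minkowskiBasis, toMatrix_blockMap]
  have : (Matrix.of fun (_ : Unit) (j : Fin 3) =>
    (0 : K3 →ₗ[ℝ] ℝ) (EuclideanSpace.basisFun (Fin 3) ℝ j)) = 0 := by ext; simp
  rw [this, Matrix.det_fromBlocks_zero₁₂, LinearMap.toMatrix_id]
  simp

/-- The Lorentz inner product as a bilinear form. -/
def lorentzForm : LinearMap.BilinForm ℝ Minkowski :=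
  LinearMap.mk₂ ℝ lorentzInner
    (by intro x y z; simp [lorentzInner, inner_add_left]; ring)
    (by intro c x y; simp [lorentzInner, inner_smul_left]; ring)
    (by intro x y z; simp [lorentzInner, inner_add_right]; ring)
    (by intro c x y; simp [lorentzInner, inner_smul_right]; ring)

theorem det_lorentzForm_ne_zero :
    (LinearMap.BilinForm.toMatrix minkowskiBasis lorentzForm).det ≠ 0 := by
  have : LinearMap.BilinForm.toMatrix minkowskiBasis lorentzForm =
      Matrix.fromBlocks (-1) 0 0 1 := by
    ext i j
    rcases i with i | i <;> rcases j with j | j <;>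
      simp [LinearMap.BilinForm.toMatrix_apply, minkowskiBasis, lorentzForm, lorentzInner,
        Matrix.one_apply, EuclideanSpace.inner_single_left]
  rw [this, Matrix.det_fromBlocks_zero₂₁]
  simp

variable {g : Minkowski ≃ₗ[ℝ] Minkowski}

/-- Compare determinants in gᵀ J g = J, where J is the invertible Gram matrix of the Lorentz form.
-/
theorem IsLorentz.sq_det (hg : IsLorentz g) :
    LinearMap.det (g : Minkowski →ₗ[ℝ] Minkowski) ^ 2 = 1 := by
  have h1 : lorentzForm.comp (g : Minkowski →ₗ[ℝ] Minkowski) g = lorentzForm := by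
    ext x y <;> simp [lorentzForm, hg _ _]
  have h2 := LinearMap.BilinForm.toMatrix_comp minkowskiBasis minkowskiBasis lorentzForm
    (g : Minkowski →ₗ[ℝ] Minkowski) g
  rw [h1] at h2
  have h3 := congrArg Matrix.det h2
  rw [Matrix.det_mul, Matrix.det_mul, Matrix.det_transpose, LinearMap.det_toMatrix] at h3
  have h4 := det_lorentzForm_ne_zero
  apply mul_right_cancel₀ h4
  linear_combination -h3

/-- The projective map of `g` in the affine chart `𝕂³`. -/
def chartMap (g : Minkowski ≃ₗ[ℝ] Minkowski) (x : K3) : K3 := (g (1, x)).1⁻¹ • (g (1, x)).2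

/-- The derivative of `chartMap g`. -/
def chartDeriv (g : Minkowski ≃ₗ[ℝ] Minkowski) (x : K3) : K3 →L[ℝ] K3 :=
  LinearMap.toContinuousLinearMap <| (g (1, x)).1⁻¹ •
    (LinearMap.snd ℝ ℝ K3 ∘ₗ g.toLinearMap ∘ₗ LinearMap.inr ℝ ℝ K3 -
      (LinearMap.fst ℝ ℝ K3 ∘ₗ g.toLinearMap ∘ₗ LinearMap.inr ℝ ℝ K3).smulRight (chartMap g x))

theorem apply_one_eq_smul {x : K3} (hx : (g (1, x)).1 ≠ 0) :
    g (1, x) = (g (1, x)).1 • ((1, chartMap g x) : Minkowski) := by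
  ext1
  · simp
  · simp [chartMap, smul_smul, hx]

/-- With F the chart map, g ∘ [1 0; x 1] = [1 0; F(x) 1] ∘ [ℓ β; 0 A], and A / ℓ is the derivative
of F. Hence det g = ℓ det A, while the derivative has determinant ℓ⁻³ det A. -/
theorem det_chartDeriv {x : K3} (hx : (g (1, x)).1 ≠ 0) :
    (chartDeriv g x).det =
      LinearMap.det (g : Minkowski →ₗ[ℝ] Minkowski) / (g (1, x)).1 ^ 4 := by
  set A := LinearMap.snd ℝ ℝ K3 ∘ₗ g.toLinearMap ∘ₗ LinearMap.inr ℝ ℝ K3 -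
      (LinearMap.fst ℝ ℝ K3 ∘ₗ g.toLinearMap ∘ₗ LinearMap.inr ℝ ℝ K3).smulRight (chartMap g x)
    with hA
  have h1 : (g : Minkowski →ₗ[ℝ] Minkowski) ∘ₗ blockMap 1 0 x LinearMap.id =
      blockMap 1 0 (chartMap g x) LinearMap.id ∘ₗ blockMap (g (1, x)).1
        (LinearMap.fst ℝ ℝ K3 ∘ₗ g.toLinearMap ∘ₗ LinearMap.inr ℝ ℝ K3) 0 A := by
    refine LinearMap.ext fun v => ?_
    have h2 : blockMap 1 0 x LinearMap.id v = v.1 • ((1, x) : Minkowski) + (0, v.2) := by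
      simp [blockMap_apply]
    simp only [LinearMap.comp_apply, LinearEquiv.coe_coe]
    rw [h2, map_add, map_smul, apply_one_eq_smul hx]
    simp only [blockMap_apply, hA]
    ext1
    · simp; ring
    · simp only [smul_zero, zero_add, LinearMap.id_apply,
        LinearMap.sub_apply, LinearMap.comp_apply, LinearMap.inr_apply, LinearMap.smulRight_apply,
        LinearMap.snd_apply, LinearMap.fst_apply, Prod.snd_add, Prod.smul_snd,
        LinearEquiv.coe_coe, Prod.smul_fst, smul_eq_mul, mul_one]
      module
  have h2 := congrArg LinearMap.det h1
  rw [LinearMap.det_comp, LinearMap.det_comp, det_blockMap_lower, det_blockMap_lower,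
    det_blockMap_upper] at h2
  have h3 : (chartDeriv g x).det = (g (1, x)).1⁻¹ ^ 3 * LinearMap.det A := by
    change LinearMap.det ((g (1, x)).1⁻¹ • A) = _
    rw [LinearMap.det_smul]
    simp
  rw [h3]
  field_simp
  linear_combination -h2

theorem IsLorentz.abs_det_chartDeriv (hg : IsLorentz g) {x : K3} (hx : (g (1, x)).1 ≠ 0) :
    |(chartDeriv g x).det| = ((g (1, x)).1 ^ 4)⁻¹ := by
  have h : |LinearMap.det (g : Minkowski →ₗ[ℝ] Minkowski)| = 1 := by
    have := hg.sq_det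
    rcases sq_eq_one_iff.1 this with h | h <;> simp [h]
  rw [det_chartDeriv hx, abs_div, h, one_div, abs_of_nonneg (by positivity)]

theorem hasFDerivAt_chartMap {x : K3} (hx : (g (1, x)).1 ≠ 0) :
    HasFDerivAt (chartMap g) (chartDeriv g x) x := by
  let G : Minkowski →L[ℝ] Minkowski := LinearMap.toContinuousLinearMap g.toLinearMap
  have h0 : HasFDerivAt (fun x : K3 => ((1, x) : Minkowski)) (ContinuousLinearMap.inr ℝ ℝ K3) x :=
    hasFDerivAt_prodMk_right (1 : ℝ) x
  have h1 : HasFDerivAt (fun x : K3 => g (1, x)) (G ∘L ContinuousLinearMap.inr ℝ ℝ K3) x :=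
    G.hasFDerivAt.comp x h0
  have h2 := ((hasDerivAt_inv hx).comp_hasFDerivAt x h1.fst).smul h1.snd
  refine h2.congr_fderiv ?_
  ext1 v
  simp only [chartDeriv, chartMap, G]
  simp
  module

/-- The zero set is empty or a translate of ker L. In the second case ker L is proper: otherwise the
time coordinate would vanish on the whole image of g, against surjectivity. -/
theorem ae_apply_one_ne_zero (g : Minkowski ≃ₗ[ℝ] Minkowski) :
    ∀ᵐ x : K3, (g (1, x)).1 ≠ 0 := by
  let L : K3 →ₗ[ℝ] ℝ := LinearMap.fst ℝ ℝ K3 ∘ₗ g.toLinearMap ∘ₗ LinearMap.inr ℝ ℝ K3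
  have hL : ∀ x y : K3, (g (1, x)).1 = (g (1, y)).1 + L (x - y) := by
    intro x y
    have : ((1, x) : Minkowski) = (1, y) + (0, x - y) := by simp
    rw [this, map_add]; rfl
  have hnull : volume {x : K3 | (g (1, x)).1 = 0} = 0 := by
    rcases eq_empty_or_nonempty {x : K3 | (g (1, x)).1 = 0} with h | ⟨y, hy⟩
    · simp [h]
    have h1 : {x : K3 | (g (1, x)).1 = 0} = (fun x => x - y) ⁻¹' (LinearMap.ker L : Set K3) := by
      ext x
      have hy' : (g (1, y)).1 = 0 := hy
      simp [hL x y, hy']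
    rw [h1]
    simp only [sub_eq_add_neg, measure_preimage_add_right]
    apply Measure.addHaar_submodule
    intro htop
    obtain ⟨v, hv⟩ := g.surjective (1, 0)
    have h2 : v = v.1 • ((1, y) : Minkowski) + (0, v.2 - v.1 • y) := by ext1 <;> simp
    have h3 : L (v.2 - v.1 • y) = 0 := by
      have : v.2 - v.1 • y ∈ LinearMap.ker L := htop ▸ Submodule.mem_top
      simpa using this
    have h4 : (g v).1 = v.1 * (g (1, y)).1 + L (v.2 - v.1 • y) := by
      conv_lhs => rw [h2, map_add, map_smul]
      rfl
    rw [h3, show (g (1, y)).1 = 0 from hy, hv] at h4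
    simp at h4
  exact compl_mem_ae_iff.2 hnull

theorem chartMap_symm_chartMap {x : K3} (hx : (g (1, x)).1 ≠ 0) :
    chartMap g.symm (chartMap g x) = x := by
  have h : g.symm (1, chartMap g x) = (g (1, x)).1⁻¹ • ((1, x) : Minkowski) := by
    apply g.injective
    rw [g.apply_symm_apply, map_smul]
    conv_rhs => rw [apply_one_eq_smul hx]
    rw [smul_smul]
    simp [hx]
  rw [chartMap, h]
  simp [smul_smul, hx]

theorem symm_apply_one_ne_zero {x : K3} (hx : (g (1, x)).1 ≠ 0) :
    (g.symm (1, chartMap g x)).1 ≠ 0 := by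
  have h : g.symm (1, chartMap g x) = (g (1, x)).1⁻¹ • ((1, x) : Minkowski) := by
    apply g.injective
    rw [g.apply_symm_apply, map_smul]
    conv_rhs => rw [apply_one_eq_smul hx]
    rw [smul_smul]
    simp [hx]
  rw [h]
  simpa using hx

theorem map_ofK3 {x : K3} (hx : (g (1, x)).1 ≠ 0) :
    Projectivization.map (g : Minkowski →ₗ[ℝ] Minkowski) g.injective (ofK3 x) =
      ofK3 (chartMap g x) := by
  rw [ofK3, ofK3, Projectivization.map_mk, Projectivization.mk_eq_mk_iff']
  exact ⟨(g (1, x)).1, (apply_one_eq_smul hx).symm⟩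

theorem affinePart_act_ae_eq (g : Minkowski ≃ₗ[ℝ] Minkowski) (U : Set ExtSpace) :
    (affinePart (act g U) : Set K3) =ᵐ[volume]
      (chartMap g '' (affinePart U ∩ {x | (g (1, x)).1 ≠ 0}) : Set K3) := by
  filter_upwards [ae_apply_one_ne_zero g.symm] with y hy
  have hx := symm_apply_one_ne_zero hy
  have hy' := chartMap_symm_chartMap hy
  rw [LinearEquiv.symm_symm] at hx hy'
  set x := chartMap g.symm y
  apply propext
  constructor
  · rintro ⟨p, hp, hpy⟩
    have : p = ofK3 x := by
      apply Projectivization.map_injective (g : Minkowski →ₗ[ℝ] Minkowski) g.injective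
      rw [hpy, map_ofK3 hx, hy']
    exact ⟨x, ⟨by rwa [this] at hp, hx⟩, hy'⟩
  · rintro ⟨z, ⟨hz, hz'⟩, rfl⟩
    exact ⟨ofK3 z, hz, map_ofK3 hz'⟩

/-- The Jacobian ℓ⁻⁴ is absorbed by the squared denominator, since P = ℓ² (d_ε² - |F|²) for the
chart map F. -/
theorem abs_det_smul_volDensity (hg : IsLorentz g) {x : K3} (hx : (g (1, x)).1 ≠ 0) (ε : ℝ) :
    |(chartDeriv g x).det| • volDensity ε (chartMap g x) = pullDensity g ε x := by
  have hx' : ((g (1, x)).1 : ℂ) ≠ 0 := by exact_mod_cast hx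
  have h1 : denom g ε x =
      ((g (1, x)).1 : ℂ) ^ 2 * (dEps ε ^ 2 - ((‖chartMap g x‖ ^ 2 : ℝ) : ℂ)) := by
    rw [denom, chartMap, norm_smul, mul_pow, norm_inv, Real.norm_eq_abs, inv_pow, sq_abs]
    push_cast
    field_simp
  rw [hg.abs_det_chartDeriv hx, pullDensity, h1, volDensity, Complex.real_smul, mul_pow,
    ← pow_mul, mul_comm (((g (1, x)).1 : ℂ) ^ (2 * 2)), ← div_div, mul_comm, div_eq_mul_inv _
      (((g (1, x)).1 : ℂ) ^ (2 * 2))]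
  push_cast
  rfl

theorem setIntegral_affinePart_act (hg : IsLorentz g) {U : Set ExtSpace}
    (hU : MeasurableSet (affinePart U)) (ε : ℝ) :
    ∫ x in affinePart (act g U), volDensity ε x = ∫ x in affinePart U, pullDensity g ε x := by
  have hopen : MeasurableSet {x : K3 | (g (1, x)).1 ≠ 0} :=
    (isOpen_ne_fun (continuous_apply_one g).fst continuous_const).measurableSet
  have hinj : InjOn (chartMap g) (affinePart U ∩ {x | (g (1, x)).1 ≠ 0}) := by
    intro x hx y hy hxy
    rw [← chartMap_symm_chartMap hx.2, hxy, chartMap_symm_chartMap hy.2]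
  rw [setIntegral_congr_set (affinePart_act_ae_eq g U),
    integral_image_eq_integral_abs_det_fderiv_smul volume (hU.inter hopen)
      (fun x hx => (hasFDerivAt_chartMap hx.2).hasFDerivWithinAt) hinj,
    setIntegral_congr_fun (hU.inter hopen)
      (fun x hx => abs_det_smul_volDensity hg hx.2 ε)]
  apply setIntegral_congr_set
  filter_upwards [ae_apply_one_ne_zero g] with x hx
  exact propext ⟨fun h => h.1, fun h => ⟨h, hx⟩⟩

end

/-! ### The logarithmic majorant and Fubini along sheared lines -/

/-- In polar coordinates this is r² log |1 - r²|, a sum of two translates of the logarithm with a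
bounded factor; `Real.log` is the logarithm of the absolute value, so both sides of the sphere are
covered. The radius 3 leaves room for all the local cutoffs. -/
theorem integrableOn_log_one_sub_sq :
    IntegrableOn (fun x : K3 => Real.log (1 - ‖x‖ ^ 2)) (Metric.closedBall 0 3) := by
  have h1 : IntervalIntegrable (fun r : ℝ => Real.log (1 - r)) volume 0 3 := by
    have := (intervalIntegral.intervalIntegrable_log' (a := 1) (b := -2)).comp_sub_left (c := 1)
    norm_num at this
    exact this
  have h2 : IntervalIntegrable (fun r : ℝ => Real.log (1 + r)) volume 0 3 := by
    have := (intervalIntegral.intervalIntegrable_log' (a := 1) (b := 4)).comp_add_left (c := 1)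
    norm_num at this
    exact this
  have h3 := (h1.add h2).continuousOn_mul (g := fun r : ℝ => r ^ 2) (by fun_prop)
  rw [intervalIntegrable_iff_integrableOn_Ioc_of_le (by norm_num)] at h3
  rw [← integrable_indicator_iff measurableSet_closedBall]
  have h4 := (integrable_fun_norm_addHaar (E := K3) volume
    (f := (Iic 3).indicator fun r : ℝ => Real.log (1 - r ^ 2))).2 ?_
  · refine h4.congr (.of_forall fun x => ?_)
    simp [indicator]
  · have h5 : IntegrableOn (fun r : ℝ => r ^ 2 * Real.log (1 - r ^ 2)) (Ioc 0 3) := by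
      refine h3.congr_fun_ae ?_
      have : ∀ᵐ r : ℝ, r ≠ 1 := by simp [ae_iff]
      refine (ae_restrict_iff' measurableSet_Ioc).2 ?_
      filter_upwards [this] with r hr hr'
      have h6 : 1 - r ≠ 0 := fun h => hr (by linarith)
      have h7 : 1 + r ≠ 0 := by linarith [hr'.1]
      rw [← Real.log_mul h6 h7]
      ring_nf
    have h6 : (Ioc (0 : ℝ) 3) = Ioi 0 ∩ Iic 3 := by ext; simp
    rw [h6, inter_comm, ← integrableOn_indicator_iff measurableSet_Iic] at h5
    refine h5.congr (.of_forall fun r => ?_)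
    by_cases h : r ≤ 3 <;> simp [indicator, h]

/-- Coordinates `((t, z), u)` of `𝕂³` in which the lines in the directions `e₂ + b(t) e₁` are the
coordinate lines of `z`. -/
def shear (e : OrthonormalBasis (Fin 3) ℝ K3) (b : ℝ → ℝ) (p : (ℝ × ℝ) × ℝ) : K3 :=
  p.1.1 • e 0 + (p.2 + b p.1.1 * p.1.2) • e 1 + p.1.2 • e 2

/-- For fixed (t, z) the shear merely translates u by b(t) z, so measurability of b is enough. -/
theorem measurePreserving_shear (e : OrthonormalBasis (Fin 3) ℝ K3) {b : ℝ → ℝ}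
    (hb : Measurable b) : MeasurePreserving (shear e b) := by
  have h1 : MeasurePreserving (fun p : (ℝ × ℝ) × ℝ => (p.1, p.2 + b p.1.1 * p.1.2)) := by
    refine (MeasurePreserving.id (volume : Measure (ℝ × ℝ))).skew_product
      (g := fun q u => u + b q.1 * q.2) (by fun_prop) (.of_forall fun q => ?_)
    exact (measurePreserving_add_right volume (b q.1 * q.2)).map_eq
  have h2 : MeasurePreserving (Prod.swap : (ℝ × ℝ) × ℝ → ℝ × (ℝ × ℝ)) :=
    Measure.measurePreserving_swap
  have h3 : MeasurePreserving (Prod.map id (MeasurableEquiv.finTwoArrow (α := ℝ)).symm :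
      ℝ × (ℝ × ℝ) → ℝ × (Fin 2 → ℝ)) volume volume :=
    (MeasurePreserving.id (volume : Measure ℝ)).prod (volume_preserving_finTwoArrow ℝ).symm
  have h4 := (volume_preserving_piFinSuccAbove (fun _ : Fin 3 => ℝ) 1).symm
  have h5 := PiLp.volume_preserving_toLp (Fin 3)
  have h6 := e.measurePreserving_repr_symm
  convert! h6.comp (h5.comp (h4.comp (h3.comp (h2.comp h1)))) using 1
  ext1 p
  simp only [Function.comp_apply]
  rw [← e.sum_repr_symm]
  simp [Fin.sum_univ_three, shear, MeasurableEquiv.piFinSuccAbove, MeasurableEquiv.finTwoArrow,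
    MeasurableEquiv.piFinTwo]
  rfl

theorem inner_shear (e : OrthonormalBasis (Fin 3) ℝ K3) (b : ℝ → ℝ) (p : (ℝ × ℝ) × ℝ) :
    inner ℝ (e 0) (shear e b p) = p.1.1 ∧
    inner ℝ (e 1) (shear e b p) = p.2 + b p.1.1 * p.1.2 ∧
    inner ℝ (e 2) (shear e b p) = p.1.2 := by
  have h := orthonormal_iff_ite.1 e.orthonormal
  simp only [shear, inner_add_right, inner_smul_right, h]
  simp

theorem measurableEmbedding_shear (e : OrthonormalBasis (Fin 3) ℝ K3) {b : ℝ → ℝ}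
    (hb : Measurable b) : MeasurableEmbedding (shear e b) := by
  refine (measurePreserving_shear e hb).measurable.measurableEmbedding fun p q hpq => ?_
  obtain ⟨h1, h2, h3⟩ := inner_shear e b p
  obtain ⟨h1', h2', h3'⟩ := inner_shear e b q
  rw [hpq] at h1 h2 h3
  have h4 : p.1.1 = q.1.1 := h1.symm.trans h1'
  have h5 : p.1.2 = q.1.2 := h3.symm.trans h3'
  have h6 := h2.symm.trans h2'
  rw [h4, h5] at h6
  ext1
  · ext1 <;> assumption
  · simpa using h6

theorem integral_eq_zero_of_lines (e : OrthonormalBasis (Fin 3) ℝ K3) {b : ℝ → ℝ}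
    (hb : Measurable b) {G : K3 → ℂ} (hG : Integrable G)
    (h : ∀ t u : ℝ, ∫ z : ℝ, G (t • e 0 + u • e 1 + z • (e 2 + b t • e 1)) = 0) :
    ∫ x, G x = 0 := by
  have hm := measurePreserving_shear e hb
  have he := measurableEmbedding_shear e hb
  rw [← hm.integral_comp he]
  have hi : Integrable (fun p => G (shear e b p)) := (hm.integrable_comp_emb he).2 hG
  have hs : MeasurePreserving (MeasurableEquiv.prodAssoc : (ℝ × ℝ) × ℝ ≃ᵐ ℝ × ℝ × ℝ) :=
    volume_preserving_prodAssoc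
  have hi2 : Integrable (fun p : ℝ × ℝ × ℝ => G (shear e b ((p.1, p.2.1), p.2.2))) :=
    (hs.integrable_comp_emb (MeasurableEquiv.measurableEmbedding _)).1 hi
  have h3 := hs.integral_comp (MeasurableEquiv.measurableEmbedding _)
    (fun p : ℝ × ℝ × ℝ => G (shear e b ((p.1, p.2.1), p.2.2)))
  refine h3.trans ?_
  rw [Measure.volume_eq_prod, integral_prod _ hi2]
  refine integral_eq_zero_of_ae ?_
  filter_upwards [hi2.prod_right_ae] with t ht
  rw [Measure.volume_eq_prod, integral_prod_symm _ ht]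
  refine integral_eq_zero_of_ae (.of_forall fun u => ?_)
  refine Eq.trans ?_ (h t u)
  refine integral_congr_ae (.of_forall fun z => ?_)
  simp only [shear]
  congr 1
  module

/-! ### Two integrations by parts along a line -/

section

/-- The derivative of `denom g ε` at `x` in the direction `w`, for a Lorentz map `g`. -/
def denomDeriv (g : Minkowski ≃ₗ[ℝ] Minkowski) (ε : ℝ) (x w : K3) : ℂ :=
  ((-2 * inner ℝ x w : ℝ) : ℂ) -
    (2 * ε * Complex.I + ε ^ 2) * ((2 * (g (1, x)).1 * (g (0, w)).1 : ℝ) : ℂ)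

/-- The second derivative of `denom g ε` in the direction `w`, for a Lorentz map `g`. -/
def denomDeriv₂ (g : Minkowski ≃ₗ[ℝ] Minkowski) (ε : ℝ) (w : K3) : ℂ :=
  ((-2 * ‖w‖ ^ 2 : ℝ) : ℂ) -
    (2 * ε * Complex.I + ε ^ 2) * ((2 * (g (0, w)).1 ^ 2 : ℝ) : ℂ)

variable {g : Minkowski ≃ₗ[ℝ] Minkowski}

theorem hasDerivAt_apply_line (g : Minkowski ≃ₗ[ℝ] Minkowski) (y w : K3) (z : ℝ) :
    HasDerivAt (fun z : ℝ => (g (1, y + z • w)).1) (g (0, w)).1 z := by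
  have h : ∀ z : ℝ, (g (1, y + z • w)).1 = (g (1, y)).1 + z * (g (0, w)).1 := by
    intro z
    have : ((1, y + z • w) : Minkowski) = (1, y) + z • (0, w) := by simp
    rw [this, map_add, map_smul]
    simp
  simp only [h]
  simpa using ((hasDerivAt_id z).mul_const (g (0, w)).1).const_add (g (1, y)).1

theorem hasDerivAt_line (y w : K3) (z : ℝ) : HasDerivAt (fun z : ℝ => y + z • w) w z := by
  simpa using ((hasDerivAt_id z).smul_const w).const_add y

theorem IsLorentz.hasDerivAt_denom (hg : IsLorentz g) (ε : ℝ) (y w : K3) (z : ℝ) :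
    HasDerivAt (fun z : ℝ => denom g ε (y + z • w)) (denomDeriv g ε (y + z • w) w) z := by
  simp only [hg.denom_eq]
  have h1 := (hasDerivAt_line y w z).norm_sq
  have h2 := (h1.const_sub 1).ofReal_comp
  have h3 := ((hasDerivAt_apply_line g y w z).pow 2).ofReal_comp
  have h4 := h2.sub (h3.const_mul (2 * ε * Complex.I + ε ^ 2 : ℂ))
  refine (h4.congr_deriv ?_).congr_of_eventuallyEq (.of_forall fun z => ?_)
  · simp only [denomDeriv]; push_cast; ring
  · simp

theorem hasDerivAt_denomDeriv (g : Minkowski ≃ₗ[ℝ] Minkowski) (ε : ℝ) (y w : K3) (z : ℝ) :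
    HasDerivAt (fun z : ℝ => denomDeriv g ε (y + z • w) w) (denomDeriv₂ g ε w) z := by
  have h1 := (((hasDerivAt_line y w z).inner ℝ (hasDerivAt_const z w)).const_mul
    (-2 : ℝ)).ofReal_comp
  have h3 := (((hasDerivAt_apply_line g y w z).const_mul 2).mul_const (g (0, w)).1).ofReal_comp
  have h4 := h1.sub (h3.const_mul (2 * ε * Complex.I + ε ^ 2 : ℂ))
  refine (h4.congr_deriv ?_)
  simp only [denomDeriv₂, inner_zero_right, real_inner_self_eq_norm_sq]
  push_cast
  ring

/-- The coefficient of the logarithm after two integrations by parts of `χ / P²` in the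
direction `w`; here `p` and `q` are the first two derivatives of `P`. -/
def partsKernel (χ : K3 → ℝ) (x w : K3) (p q : ℂ) : ℂ :=
  ((fderiv ℝ (fderiv ℝ χ) x w w : ℂ) * p ^ 2 - 3 * ((fderiv ℝ χ x w : ℂ) * p - χ x * q) * q) /
    p ^ 4

variable {χ : K3 → ℝ}

/-- Im P ≤ 0 places iP in the closed right half-plane, and P ≠ 0 excludes the origin. The half-plane
is the same for all g, which is why one branch of the logarithm serves them all. -/
theorem mul_denom_mem_slitPlane (g : Minkowski ≃ₗ[ℝ] Minkowski) {ε : ℝ} (hε : 0 < ε) (x : K3) :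
    Complex.I * denom g ε x ∈ Complex.slitPlane := by
  have h0 := denom_ne_zero g hε x
  rw [Complex.mem_slitPlane_iff]
  simp only [Complex.mul_re, Complex.mul_im, Complex.I_re, Complex.I_im, zero_mul, one_mul,
    zero_sub, zero_add]
  have h1 : (denom g ε x).im ≤ 0 := by rw [denom_im, neg_nonpos]; positivity
  by_contra! h
  exact h0 (Complex.ext h.2 (le_antisymm h1 (neg_nonpos.1 h.1)))

theorem eventually_eq_zero_of_notMem_tsupport {x : K3} (hx : x ∉ tsupport χ) :
    ∀ᶠ y in 𝓝 x, χ y = 0 ∧ fderiv ℝ χ y = 0 ∧ fderiv ℝ (fderiv ℝ χ) y = 0 := by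
  have h1 := notMem_tsupport_iff_eventuallyEq.1 hx
  have h2 := h1.fderiv (𝕜 := ℝ)
  have h3 := h2.fderiv (𝕜 := ℝ)
  filter_upwards [h1, h2, h3] with y hy1 hy2 hy3
  refine ⟨hy1, ?_, ?_⟩
  · rw [hy2]; exact fderiv_const_apply (𝕜 := ℝ) (0 : ℝ)
  · rw [hy3]
    have : fderiv ℝ (0 : K3 → ℝ) = fun _ => 0 := by
      ext1 y; exact fderiv_const_apply (𝕜 := ℝ) (0 : ℝ)
    rw [this]
    exact fderiv_const_apply _

theorem partsKernel_eq_zero {x : K3} (hx : x ∉ tsupport χ) (w : K3) (p q : ℂ) :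
    partsKernel χ x w p q = 0 := by
  obtain ⟨h1, h2, h3⟩ := (eventually_eq_zero_of_notMem_tsupport hx).self_of_nhds
  simp [partsKernel, h1, h2, h3]

theorem continuous_denomDeriv (g : Minkowski ≃ₗ[ℝ] Minkowski) (ε : ℝ) :
    Continuous fun y : K3 × K3 => denomDeriv g ε y.1 y.2 := by
  have h1 : Continuous fun y : K3 × K3 => (g (1, y.1)).1 :=
    ((continuous_apply_one g).comp continuous_fst).fst
  have h2 : Continuous fun y : K3 × K3 => (g (0, y.2)).1 :=
    (g.toLinearMap.continuous_of_finiteDimensional.comp (by fun_prop)).fst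
  unfold denomDeriv
  fun_prop

theorem continuous_denomDeriv₂ (g : Minkowski ≃ₗ[ℝ] Minkowski) (ε : ℝ) :
    Continuous (denomDeriv₂ g ε) := by
  have h2 : Continuous fun y : K3 => (g (0, y)).1 :=
    (g.toLinearMap.continuous_of_finiteDimensional.comp (by fun_prop)).fst
  unfold denomDeriv₂
  fun_prop

/-- Write X / P² = -(X / p)(1 / P)', integrate by parts, write 1 / P = (log(iP))' / p and integrate
again. As P is quadratic along the line, q is constant and no further derivative appears. The
resulting integrand is minus the derivative of a compactly supported function. -/
theorem integral_div_sq_add_log_eq_zero {X X' X'' P p : ℝ → ℂ} {q : ℂ} {K : Set ℝ}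
    (hX : ∀ z, HasDerivAt X (X' z) z) (hX' : ∀ z, HasDerivAt X' (X'' z) z)
    (hX'' : Continuous X'') (hP : ∀ z, HasDerivAt P (p z) z) (hp : ∀ z, HasDerivAt p q z)
    (hK : IsCompact K) (hXK : ∀ z ∉ K, X z = 0) (hpK : ∀ z ∈ K, p z ≠ 0)
    (hlog : ∀ z, Complex.I * P z ∈ Complex.slitPlane) :
    ∫ z, (X z / P z ^ 2 + (X'' z * p z ^ 2 - 3 * (X' z * p z - X z * q) * q) / p z ^ 4 *
      Complex.log (Complex.I * P z)) = 0 := by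
  have hP0 : ∀ z, P z ≠ 0 := fun z h => Complex.slitPlane_ne_zero (hlog z) (by simp [h])
  have hXc : Continuous X := continuous_iff_continuousAt.2 fun z => (hX z).continuousAt
  have hXc' : Continuous X' := continuous_iff_continuousAt.2 fun z => (hX' z).continuousAt
  have hPc : Continuous P := continuous_iff_continuousAt.2 fun z => (hP z).continuousAt
  have hpc : Continuous p := continuous_iff_continuousAt.2 fun z => (hp z).continuousAt
  have hlogc : Continuous fun z => Complex.log (Complex.I * P z) :=
    (continuous_const.mul hPc).clog hlog
  -- The complement of K is open, so the vanishing of X passes to its derivatives. Off K, where p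
  -- may vanish, all quotients are then locally 0.
  have hout : ∀ z ∉ K, ∀ᶠ s in 𝓝 z, X s = 0 ∧ X' s = 0 ∧ X'' s = 0 := by
    intro z hz
    have h1 : X =ᶠ[𝓝 z] 0 := by
      filter_upwards [hK.isClosed.isOpen_compl.mem_nhds hz] with s hs using hXK s hs
    have h2 : X' =ᶠ[𝓝 z] 0 := by
      filter_upwards [h1.eventuallyEq_nhds] with s hs
      exact (hX s).unique ((hasDerivAt_const s (0 : ℂ)).congr_of_eventuallyEq hs)
    filter_upwards [h1, h2, h2.eventuallyEq_nhds] with s hs1 hs2 hs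
    exact ⟨hs1, hs2, (hX' s).unique ((hasDerivAt_const s (0 : ℂ)).congr_of_eventuallyEq hs)⟩
  set H : ℝ → ℂ := fun z => X z / p z / P z -
    (X' z * p z - X z * q) / p z ^ 3 * Complex.log (Complex.I * P z) with hHdef
  set H' : ℝ → ℂ := fun z => X z / P z ^ 2 +
    (X'' z * p z ^ 2 - 3 * (X' z * p z - X z * q) * q) / p z ^ 4 *
      Complex.log (Complex.I * P z) with hHdef'
  have hH : ∀ z, HasDerivAt H (-H' z) z := by
    intro z
    by_cases hz : z ∈ K
    · have hpz := hpK z hz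
      have hPz := hP0 z
      have h3 := ((hX z).div (hp z) hpz).div (hP z) hPz
      have h4 := (((hX' z).mul (hp z)).sub ((hX z).mul_const q)).div ((hp z).pow 3)
        (pow_ne_zero _ hpz)
      have h5 := ((hP z).const_mul Complex.I).clog_real (hlog z)
      refine (h3.sub (h4.mul h5)).congr_deriv ?_
      simp only [hHdef', Pi.mul_apply, Pi.sub_apply, Pi.div_apply, Pi.pow_apply]
      field_simp
      push_cast
      ring
    · have h0 := hout z hz
      have h1 := h0.self_of_nhds
      simp only [hHdef', h1.1, h1.2.1, h1.2.2]
      simp only [zero_div, zero_mul, mul_zero, sub_zero, add_zero, neg_zero]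
      refine (hasDerivAt_const z (0 : ℂ)).congr_of_eventuallyEq ?_
      filter_upwards [h0] with s hs
      simp [H, hs.1, hs.2.1]
  have hHc' : Continuous H' := by
    refine continuous_iff_continuousAt.2 fun z => ?_
    by_cases hz : z ∈ K
    · have := hpK z hz
      have := hP0 z
      have h1 : ContinuousAt (fun z => X z / P z ^ 2) z := by fun_prop (disch := simpa)
      have h2 : ContinuousAt
          (fun z => (X'' z * p z ^ 2 - 3 * (X' z * p z - X z * q) * q) / p z ^ 4) z := by
        fun_prop (disch := simpa)
      exact h1.add (h2.mul hlogc.continuousAt)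
    · refine (continuousAt_const (y := (0 : ℂ))).congr ?_
      filter_upwards [hout z hz] with s hs
      simp [H', hs.1, hs.2.1, hs.2.2]
  have hs' : HasCompactSupport H' := by
    refine HasCompactSupport.intro hK fun z hz => ?_
    have := (hout z hz).self_of_nhds
    simp [H', this.1, this.2.1, this.2.2]
  have hs : HasCompactSupport H := by
    refine HasCompactSupport.intro hK fun z hz => ?_
    have := (hout z hz).self_of_nhds
    simp [H, this.1, this.2.1]
  have hHc : Continuous H := continuous_iff_continuousAt.2 fun z => (hH z).continuousAt
  have h := integral_eq_zero_of_hasDerivAt_of_integrable hH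
    (hHc'.integrable_of_hasCompactSupport hs').neg (hHc.integrable_of_hasCompactSupport hs)
  simpa [integral_neg] using h

theorem hasDerivAt_comp_line {E : Type*} [NormedAddCommGroup E] [NormedSpace ℝ E] {f : K3 → E}
    (hf : Differentiable ℝ f) (y w : K3) (z : ℝ) :
    HasDerivAt (fun z : ℝ => f (y + z • w)) (fderiv ℝ f (y + z • w) w) z :=
  HasFDerivAt.comp_hasDerivAt z (hf (y + z • w)).hasFDerivAt (hasDerivAt_line y w z)

theorem isCompact_preimage_line {K : Set K3} (hK : IsCompact K) (y : K3) {w : K3} (hw : w ≠ 0) :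
    IsCompact ((fun z : ℝ => y + z • w) ⁻¹' K) :=
  ((Homeomorph.addLeft y).isClosedEmbedding.comp
    (isClosedEmbedding_smul_left hw)).isCompact_preimage hK

theorem integral_line_eq_zero (hg : IsLorentz g) (hχ : ContDiff ℝ ∞ χ) (hc : HasCompactSupport χ)
    {ε : ℝ} (hε : 0 < ε) {w : K3} (hw : w ≠ 0) (hP : ∀ x ∈ tsupport χ, denomDeriv g ε x w ≠ 0)
    (y : K3) :
    ∫ z : ℝ, ((χ (y + z • w) : ℂ) / denom g ε (y + z • w) ^ 2 +
      partsKernel χ (y + z • w) w (denomDeriv g ε (y + z • w) w) (denomDeriv₂ g ε w) *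
        Complex.log (Complex.I * denom g ε (y + z • w))) = 0 := by
  have hdχ : ContDiff ℝ ∞ (fderiv ℝ χ) := hχ.fderiv_right (by simp)
  have hddχ : Continuous (fderiv ℝ (fderiv ℝ χ)) := hdχ.continuous_fderiv (by simp)
  have hline : Continuous fun z : ℝ => y + z • w := by fun_prop
  refine integral_div_sq_add_log_eq_zero (K := (fun z : ℝ => y + z • w) ⁻¹' tsupport χ)
    (X' := fun z => ((fderiv ℝ χ (y + z • w) w : ℝ) : ℂ))
    (X'' := fun z => ((fderiv ℝ (fderiv ℝ χ) (y + z • w) w w : ℝ) : ℂ))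
    (p := fun z => denomDeriv g ε (y + z • w) w) ?_ ?_ ?_ ?_ ?_ ?_ ?_ ?_ ?_
  · exact fun z => (hasDerivAt_comp_line (hχ.differentiable (by simp)) y w z).ofReal_comp
  · intro z
    have h := (hasDerivAt_comp_line (hdχ.differentiable (by simp)) y w z).clm_apply
      (hasDerivAt_const z w)
    simpa using h.ofReal_comp
  · have := hddχ.comp hline
    exact Complex.continuous_ofReal.comp
      ((this.clm_apply continuous_const).clm_apply continuous_const)
  · exact hg.hasDerivAt_denom ε y w
  · exact hasDerivAt_denomDeriv g ε y w
  · exact isCompact_preimage_line hc y hw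
  · intro z hz
    simp [image_eq_zero_of_notMem_tsupport hz]
  · exact fun z hz => hP _ hz
  · exact fun z => mul_denom_mem_slitPlane g hε _

end

/-! ### Bounds uniform in ε -/

section

variable {g : Minkowski ≃ₗ[ℝ] Minkowski} {χ : K3 → ℝ}

theorem norm_dEps_correction_le {ε : ℝ} (h0 : 0 ≤ ε) (h1 : ε ≤ 1) :
    ‖(2 * ε * Complex.I + ε ^ 2 : ℂ)‖ ≤ 3 * ε := by
  refine (norm_add_le _ _).trans ?_
  simp [abs_of_nonneg h0]
  nlinarith

/-- At ε = 0 the first derivative is -2⟨x, w⟩, of absolute value at least 3/2, and the correction is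
O(ε); so for small ε it stays at least 1. -/
theorem exists_denomDeriv_bounds (g : Minkowski ≃ₗ[ℝ] Minkowski) {R : ℝ} (hR : 0 ≤ R) :
    ∃ M : ℝ, ∀ᶠ ε : ℝ in 𝓝[>] 0, ∀ x w : K3, ‖x‖ ≤ 3 → ‖w‖ ≤ R → 3 / 4 ≤ |inner ℝ x w| →
      1 ≤ ‖denomDeriv g ε x w‖ ∧ ‖denomDeriv g ε x w‖ ≤ M ∧ ‖denomDeriv₂ g ε w‖ ≤ M := by
  let G : Minkowski →L[ℝ] Minkowski := LinearMap.toContinuousLinearMap g.toLinearMap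
  set C := ‖G‖
  have hC : 0 ≤ C := norm_nonneg _
  have hlam : ∀ w : K3, |(g (0, w)).1| ≤ C * ‖w‖ := by
    intro w
    refine (norm_fst_le (g (0, w))).trans ((G.le_opNorm (0, w)).trans ?_)
    simp [C, Prod.norm_def]
  have hell : ∀ x : K3, ‖x‖ ≤ 3 → |(g (1, x)).1| ≤ C * 3 := by
    intro x hx
    refine (norm_fst_le (g (1, x))).trans ((G.le_opNorm (1, x)).trans ?_)
    have : ‖((1, x) : Minkowski)‖ ≤ 3 := by
      simp [Prod.norm_def, hx]
    gcongr
  -- The correction is at most 3ε · 2(3C)(CR) = 18 C²Rε, which this choice keeps below 1/2.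
  set ε₀ := 1 / (36 * C ^ 2 * R + 1)
  have hε₀ : 0 < ε₀ := by positivity
  have hε₁ : ε₀ * (36 * C ^ 2 * R + 1) = 1 := by simp only [ε₀]; field_simp
  refine ⟨max (6 * R + 1) (2 * R ^ 2 + 6 * (C * R) ^ 2), ?_⟩
  have hε₂ : 0 < min 1 ε₀ := lt_min one_pos hε₀
  filter_upwards [Ioo_mem_nhdsGT hε₂] with ε hε x w hx hw hxw
  have h0 := hε.1.le
  have h1 : ε ≤ 1 := hε.2.le.trans (min_le_left _ _)
  have h2 : ε ≤ ε₀ := hε.2.le.trans (min_le_right _ _)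
  have hd := norm_dEps_correction_le h0 h1
  have hlw : |(g (0, w)).1| ≤ C * R := (hlam w).trans (by gcongr)
  have h3 : ‖((2 * (g (1, x)).1 * (g (0, w)).1 : ℝ) : ℂ)‖ ≤ 2 * (C * 3) * (C * R) := by
    rw [Complex.norm_real, Real.norm_eq_abs, abs_mul, abs_mul, abs_two]
    gcongr
    exact hell x hx
  have h4 : ‖(2 * ε * Complex.I + ε ^ 2 : ℂ) * ((2 * (g (1, x)).1 * (g (0, w)).1 : ℝ) : ℂ)‖
      ≤ 1 / 2 := by
    rw [norm_mul]
    calc _ ≤ 3 * ε * (2 * (C * 3) * (C * R)) := by gcongr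
      _ = ε * (36 * C ^ 2 * R) / 2 := by ring
      _ ≤ ε₀ * (36 * C ^ 2 * R) / 2 := by gcongr
      _ ≤ 1 / 2 := by nlinarith
  have h5 : ‖((-2 * inner ℝ x w : ℝ) : ℂ)‖ = 2 * |inner ℝ x w| := by
    rw [Complex.norm_real, Real.norm_eq_abs, abs_mul]; norm_num
  have h6 : |inner ℝ x w| ≤ 3 * R := (abs_real_inner_le_norm x w).trans (by gcongr)
  refine ⟨?_, le_max_of_le_left ?_, le_max_of_le_right ?_⟩
  · have := norm_sub_norm_le ((-2 * inner ℝ x w : ℝ) : ℂ)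
      ((2 * ε * Complex.I + ε ^ 2 : ℂ) * ((2 * (g (1, x)).1 * (g (0, w)).1 : ℝ) : ℂ))
    rw [denomDeriv]
    linarith
  · refine (norm_sub_le _ _).trans ?_
    linarith
  · refine (norm_sub_le _ _).trans ?_
    rw [norm_mul, Complex.norm_real, Complex.norm_real, Real.norm_eq_abs, Real.norm_eq_abs,
      abs_mul, abs_mul, abs_pow, abs_pow, abs_norm]
    have h7 : ‖(2 * ε * Complex.I + ε ^ 2 : ℂ)‖ ≤ 3 := hd.trans (by linarith)
    have h8 : ‖(2 * ε * Complex.I + ε ^ 2 : ℂ)‖ * (|2| * |(g (0, w)).1| ^ 2) ≤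
      3 * (2 * (C * R) ^ 2) := by rw [abs_two]; gcongr
    have h9 : |(-2 : ℝ)| * ‖w‖ ^ 2 ≤ 2 * R ^ 2 := by rw [abs_neg, abs_two]; gcongr
    linarith

theorem continuous_fderiv_apply (hχ : ContDiff ℝ ∞ χ) :
    Continuous fun y : K3 × K3 => fderiv ℝ χ y.1 y.2 :=
  ((hχ.continuous_fderiv (by simp)).comp continuous_fst).clm_apply continuous_snd

theorem continuous_fderiv_fderiv_apply (hχ : ContDiff ℝ ∞ χ) :
    Continuous fun y : K3 × K3 => fderiv ℝ (fderiv ℝ χ) y.1 y.2 y.2 := by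
  have hdχ : ContDiff ℝ ∞ (fderiv ℝ χ) := hχ.fderiv_right (by simp)
  have hddχ : Continuous (fderiv ℝ (fderiv ℝ χ)) := hdχ.continuous_fderiv (by simp)
  exact ((hddχ.comp continuous_fst).clm_apply continuous_snd).clm_apply continuous_snd

theorem exists_derivs_bound (hχ : ContDiff ℝ ∞ χ) (hc : HasCompactSupport χ) (R : ℝ) :
    ∃ D : ℝ, 0 ≤ D ∧ ∀ x w : K3, ‖w‖ ≤ R → |χ x| ≤ D ∧ |fderiv ℝ χ x w| ≤ D ∧
      |fderiv ℝ (fderiv ℝ χ) x w w| ≤ D := by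
  have hK : IsCompact (tsupport χ ×ˢ Metric.closedBall (0 : K3) R) :=
    hc.isCompact.prod (isCompact_closedBall _ _)
  obtain ⟨D0, h0⟩ := hK.exists_bound_of_continuousOn
    (hχ.continuous.comp continuous_fst).continuousOn
  obtain ⟨D1, h1⟩ := hK.exists_bound_of_continuousOn (continuous_fderiv_apply hχ).continuousOn
  obtain ⟨D2, h2⟩ := hK.exists_bound_of_continuousOn
    (continuous_fderiv_fderiv_apply hχ).continuousOn
  refine ⟨max 0 (max D0 (max D1 D2)), le_max_left _ _, fun x w hw => ?_⟩
  by_cases hx : x ∈ tsupport χ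
  · have hxw : (x, w) ∈ tsupport χ ×ˢ Metric.closedBall (0 : K3) R := ⟨hx, by simpa using hw⟩
    refine ⟨?_, ?_, ?_⟩
    · exact (h0 _ hxw).trans (by simp)
    · exact (h1 _ hxw).trans (by simp)
    · exact (h2 _ hxw).trans (by simp)
  · obtain ⟨h3, h4, h5⟩ := (eventually_eq_zero_of_notMem_tsupport hx).self_of_nhds
    simp [h3, h4, h5]

/-- Since |p| ≥ 1 the denominator can be dropped; 7 = 1 + 3 · 2 counts the terms of the numerator.
-/
theorem norm_partsKernel_le {D M : ℝ} (hD : 0 ≤ D) {x w : K3} {p q : ℂ} (h0 : |χ x| ≤ D)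
    (h1 : |fderiv ℝ χ x w| ≤ D) (h2 : |fderiv ℝ (fderiv ℝ χ) x w w| ≤ D) (hp : 1 ≤ ‖p‖)
    (hpM : ‖p‖ ≤ M) (hq : ‖q‖ ≤ M) : ‖partsKernel χ x w p q‖ ≤ 7 * D * M ^ 2 := by
  have hM : 0 ≤ M := (norm_nonneg _).trans hq
  rw [partsKernel, norm_div, norm_pow]
  have h3 : (1 : ℝ) ≤ ‖p‖ ^ 4 := one_le_pow₀ hp
  refine (div_le_self (norm_nonneg _) h3).trans ?_
  refine (norm_sub_le _ _).trans ?_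
  rw [norm_mul, norm_mul, norm_mul, norm_pow, Complex.norm_real, Real.norm_eq_abs]
  have h4 : ‖(fderiv ℝ χ x w : ℂ) * p - χ x * q‖ ≤ D * M + D * M := by
    refine (norm_sub_le _ _).trans ?_
    rw [norm_mul, norm_mul, Complex.norm_real, Complex.norm_real, Real.norm_eq_abs,
      Real.norm_eq_abs]
    gcongr
  have h5 : ‖(3 : ℂ)‖ = 3 := by simp
  rw [h5]
  calc _ ≤ D * M ^ 2 + 3 * (D * M + D * M) * M := by gcongr
    _ = 7 * D * M ^ 2 := by ring

theorem exists_norm_denom_le (g : Minkowski ≃ₗ[ℝ] Minkowski) :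
    ∃ M : ℝ, 1 ≤ M ∧ ∀ ε : ℝ, 0 ≤ ε → ε ≤ 1 → ∀ x : K3, ‖x‖ ≤ 3 → ‖denom g ε x‖ ≤ M := by
  obtain ⟨C, hC⟩ := (isCompact_closedBall (0 : K3) 3).exists_bound_of_continuousOn
    (continuous_apply_one g).continuousOn
  refine ⟨max 1 (2 ^ 2 * C ^ 2 + C ^ 2), le_max_left _ _, fun ε h0 h1 x hx => ?_⟩
  have hx' := hC x (by simpa using hx)
  have hC0 : 0 ≤ C := (norm_nonneg _).trans hx'
  have ha : |(g (1, x)).1| ≤ C := (norm_fst_le _).trans hx'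
  have hb : ‖(g (1, x)).2‖ ≤ C := (norm_snd_le _).trans hx'
  refine le_max_of_le_right ((norm_sub_le _ _).trans ?_)
  rw [norm_mul, norm_pow, norm_pow, Complex.norm_real, Complex.norm_real, Real.norm_eq_abs,
    Real.norm_eq_abs, abs_pow, abs_norm]
  gcongr
  exact norm_dEps_le h0 h1

/-- The real part log |z| lies between log |r| and log M, and the imaginary part is an argument. -/
theorem norm_log_le {z : ℂ} {r M : ℝ} (hr : 0 < |r|) (h : |r| ≤ ‖z‖) (hM : 1 ≤ M) (hzM : ‖z‖ ≤ M) :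
    ‖Complex.log (Complex.I * z)‖ ≤ Real.log M + |Real.log r| + Real.pi := by
  have h1 : ‖Complex.log (Complex.I * z)‖ ≤ |Real.log ‖z‖| + Real.pi := by
    refine (Complex.norm_le_abs_re_add_abs_im _).trans ?_
    rw [Complex.log_re, Complex.log_im, norm_mul, Complex.norm_I, one_mul]
    gcongr
    exact Complex.abs_arg_le_pi _
  have hz : 0 < ‖z‖ := hr.trans_le h
  have h2 : |Real.log ‖z‖| ≤ Real.log M + |Real.log r| := by
    rw [abs_le]
    constructor
    · have := Real.log_le_log hr h
      rw [Real.log_abs] at this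
      linarith [neg_abs_le (Real.log r), Real.log_nonneg hM]
    · linarith [Real.log_le_log hz hzM, abs_nonneg (Real.log r)]
  linarith

/-- The weight `χ` cut off to a set that is invariant under translations in the directions
`e₂ + b(t) e₁`. -/
def shearWeight (e : OrthonormalBasis (Fin 3) ℝ K3) (b : ℝ → ℝ) (A : Set (ℝ × ℝ)) (χ : K3 → ℝ) :
    K3 → ℝ :=
  {x | (inner ℝ (e 0) x, inner ℝ (e 1) x - b (inner ℝ (e 0) x) * inner ℝ (e 2) x) ∈ A}.indicator χ

theorem measurableSet_shear (e : OrthonormalBasis (Fin 3) ℝ K3) {b : ℝ → ℝ} (hb : Measurable b)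
    {A : Set (ℝ × ℝ)} (hA : MeasurableSet A) :
    MeasurableSet {x : K3 | (inner ℝ (e 0) x,
      inner ℝ (e 1) x - b (inner ℝ (e 0) x) * inner ℝ (e 2) x) ∈ A} := by
  have h : ∀ i, Measurable fun x : K3 => (inner ℝ (e i) x : ℝ) := fun i =>
    (continuous_const.inner continuous_id).measurable
  exact ((h 0).prodMk ((h 1).sub ((hb.comp (h 0)).mul (h 2)))) hA

theorem measurable_partsKernel (hχ : ContDiff ℝ ∞ χ) {W : K3 → K3} (hW : Measurable W)
    {p q : K3 → ℂ} (hp : Measurable p) (hq : Measurable q) :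
    Measurable fun x => partsKernel χ x (W x) (p x) (q x) := by
  have h0 : Measurable χ := hχ.continuous.measurable
  have h1' : Measurable fun x => fderiv ℝ χ x (W x) :=
    (continuous_fderiv_apply hχ).measurable.comp (measurable_id.prodMk hW)
  have h2' : Measurable fun x => fderiv ℝ (fderiv ℝ χ) x (W x) (W x) :=
    (continuous_fderiv_fderiv_apply hχ).measurable.comp (measurable_id.prodMk hW)
  unfold partsKernel
  fun_prop

end

/-! ### The limit for sets ruled by lines transversal to the sphere -/

section

variable {g : Minkowski ≃ₗ[ℝ] Minkowski} {χ : K3 → ℝ}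

theorem dEps_ne_zero (ε : ℝ) : dEps ε ≠ 0 := by
  intro h
  have := congrArg Complex.re h
  simp [dEps] at this

theorem tendsto_denomDeriv (g : Minkowski ≃ₗ[ℝ] Minkowski) (x w : K3) :
    Tendsto (fun ε => denomDeriv g ε x w) (𝓝[>] 0) (𝓝 ((-2 * inner ℝ x w : ℝ) : ℂ)) := by
  have h : Continuous fun ε : ℝ => denomDeriv g ε x w := by unfold denomDeriv; fun_prop
  have := (h.tendsto 0).mono_left (nhdsWithin_le_nhds (s := Ioi 0))
  simpa [denomDeriv] using this

theorem tendsto_denomDeriv₂ (g : Minkowski ≃ₗ[ℝ] Minkowski) (w : K3) :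
    Tendsto (fun ε => denomDeriv₂ g ε w) (𝓝[>] 0) (𝓝 ((-2 * ‖w‖ ^ 2 : ℝ) : ℂ)) := by
  have h : Continuous fun ε : ℝ => denomDeriv₂ g ε w := by unfold denomDeriv₂; fun_prop
  have := (h.tendsto 0).mono_left (nhdsWithin_le_nhds (s := Ioi 0))
  simpa [denomDeriv₂] using this

theorem IsLorentz.tendsto_log_denom (hg : IsLorentz g) {x : K3} (hx : ‖x‖ ≠ 1) :
    Tendsto (fun ε => Complex.log (Complex.I * denom g ε x)) (𝓝[>] 0)
      (𝓝 (Complex.log (Complex.I * ((1 - ‖x‖ ^ 2 : ℝ) : ℂ)))) := by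
  refine ((hg.tendsto_denom x).const_mul _).clog ?_
  rw [Complex.mem_slitPlane_iff]
  right
  rw [Complex.mul_im]
  simpa only [Complex.I_re, Complex.I_im, Complex.ofReal_im, Complex.ofReal_re, zero_mul, one_mul,
    zero_add] using one_sub_sq_ne_zero hx

theorem partsKernel_tendsto {x w : K3} {p q : ℝ → ℂ} {p₀ q₀ : ℂ} (hp : Tendsto p (𝓝[>] 0) (𝓝 p₀))
    (hq : Tendsto q (𝓝[>] 0) (𝓝 q₀)) (h0 : x ∈ tsupport χ → p₀ ≠ 0) :
    Tendsto (fun ε => partsKernel χ x w (p ε) (q ε)) (𝓝[>] 0) (𝓝 (partsKernel χ x w p₀ q₀)) := by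
  by_cases hx : x ∈ tsupport χ
  · unfold partsKernel
    refine Tendsto.div ?_ (hp.pow 4) (pow_ne_zero _ (h0 hx))
    exact ((hp.pow 2).const_mul _).sub
      ((((hp.const_mul _).sub (hq.const_mul _)).const_mul 3).mul hq)
  · simp only [partsKernel_eq_zero hx]
    exact tendsto_const_nhds

/-- The integrand that remains after two integrations by parts in the direction `w`. -/
def partsIntegrand (χ : K3 → ℝ) (g : Minkowski ≃ₗ[ℝ] Minkowski) (ε : ℝ) (x w : K3) : ℂ :=
  partsKernel χ x w (denomDeriv g ε x w) (denomDeriv₂ g ε w) *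
    Complex.log (Complex.I * denom g ε x)

/-- The limit of `partsIntegrand` as `ε → 0+`; it does not depend on the Lorentz map. -/
def partsLimit (χ : K3 → ℝ) (x w : K3) : ℂ :=
  partsKernel χ x w ((-2 * inner ℝ x w : ℝ) : ℂ) ((-2 * ‖w‖ ^ 2 : ℝ) : ℂ) *
    Complex.log (Complex.I * ((1 - ‖x‖ ^ 2 : ℝ) : ℂ))

theorem IsLorentz.tendsto_partsIntegrand (hg : IsLorentz g) {x w : K3} (hx : ‖x‖ ≠ 1)
    (hw : x ∈ tsupport χ → (inner ℝ x w : ℝ) ≠ 0) :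
    Tendsto (fun ε => partsIntegrand χ g ε x w) (𝓝[>] 0) (𝓝 (partsLimit χ x w)) := by
  have h0 : x ∈ tsupport χ → ((-2 * inner ℝ x w : ℝ) : ℂ) ≠ 0 := by
    intro h
    rw [Complex.ofReal_ne_zero]
    exact mul_ne_zero (by norm_num) (hw h)
  have hp := tendsto_denomDeriv g x w
  have hq := tendsto_denomDeriv₂ g w
  have h1 := partsKernel_tendsto (w := w) hp hq h0
  unfold partsIntegrand partsLimit
  exact h1.mul (hg.tendsto_log_denom hx)

theorem measurable_partsIntegrand (hχ : ContDiff ℝ ∞ χ) {W : K3 → K3} (hW : Measurable W)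
    (g : Minkowski ≃ₗ[ℝ] Minkowski) (ε : ℝ) :
    Measurable fun x => partsIntegrand χ g ε x (W x) := by
  have h0 : Measurable fun x => (x, W x) := measurable_id.prodMk hW
  have h1 : Measurable fun x => denomDeriv g ε x (W x) :=
    Measurable.comp (f := fun x => (x, W x)) (continuous_denomDeriv g ε).measurable h0
  have h2 : Measurable fun x => denomDeriv₂ g ε (W x) :=
    (continuous_denomDeriv₂ g ε).measurable.comp hW
  have h3 : Measurable fun x => Complex.log (Complex.I * denom g ε x) :=
    Complex.measurable_log.comp ((continuous_denom g ε).measurable.const_mul _)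
  exact (measurable_partsKernel hχ hW h1 h2).mul h3

/-- The kernel is bounded and the logarithm is dominated by |log |1 - |x|²|| plus a constant. The
majorant may depend on g; only the limit must not. -/
theorem IsLorentz.exists_partsIntegrand_bound (hg : IsLorentz g) (hχ : ContDiff ℝ ∞ χ)
    (hc : HasCompactSupport χ) (hball : ∀ x ∈ tsupport χ, ‖x‖ ≤ 3) {R : ℝ} (hR : 0 ≤ R) :
    ∃ bd : K3 → ℝ, Integrable bd ∧ ∀ᶠ ε : ℝ in 𝓝[>] 0, ∀ x w : K3, ‖w‖ ≤ R → ‖x‖ ≠ 1 →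
      (x ∈ tsupport χ → 3 / 4 ≤ |inner ℝ x w|) → ‖partsIntegrand χ g ε x w‖ ≤ bd x := by
  obtain ⟨D, hD, hDb⟩ := exists_derivs_bound hχ hc R
  obtain ⟨M, hM⟩ := exists_denomDeriv_bounds g hR
  obtain ⟨M', hM', hden⟩ := exists_norm_denom_le g
  refine ⟨(Metric.closedBall 0 3).indicator fun x =>
    7 * D * M ^ 2 * (Real.log M' + |Real.log (1 - ‖x‖ ^ 2)| + Real.pi), ?_, ?_⟩
  · rw [integrable_indicator_iff measurableSet_closedBall]
    have hconst : ∀ c : ℝ, IntegrableOn (fun _ : K3 => c) (Metric.closedBall 0 3) := fun c =>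
      integrableOn_const (measure_closedBall_lt_top.ne)
    exact (((hconst _).add integrableOn_log_one_sub_sq.abs).add (hconst _)).const_mul _
  filter_upwards [hM, Ioc_mem_nhdsGT (zero_lt_one (α := ℝ))] with ε hMε hε x w hw hx1 hin
  by_cases hx : x ∈ tsupport χ
  · have hx3 := hball x hx
    have hxb : x ∈ Metric.closedBall (0 : K3) 3 := by simpa using hx3
    rw [indicator_of_mem hxb, partsIntegrand, norm_mul]
    obtain ⟨h1, h2, h3⟩ := hMε x w hx3 hw (hin hx)
    obtain ⟨d0, d1, d2⟩ := hDb x w hw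
    have h4 := norm_partsKernel_le hD d0 d1 d2 h1 h2 h3
    have h5 := norm_log_le (abs_pos.2 (one_sub_sq_ne_zero hx1)) (hg.abs_le_norm_denom ε x) hM'
      (hden ε hε.1.le hε.2 x hx3)
    gcongr
  · rw [partsIntegrand, partsKernel_eq_zero hx, zero_mul, norm_zero]
    refine indicator_nonneg (fun y _ => ?_) _
    have := Real.log_nonneg hM'
    have := Real.pi_pos
    positivity

theorem shearWeight_apply_line {e : OrthonormalBasis (Fin 3) ℝ K3} {b : ℝ → ℝ} (t u z : ℝ) :
    inner ℝ (e 0) (t • e 0 + u • e 1 + z • (e 2 + b t • e 1)) = t ∧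
    inner ℝ (e 1) (t • e 0 + u • e 1 + z • (e 2 + b t • e 1)) = u + b t * z ∧
    inner ℝ (e 2) (t • e 0 + u • e 1 + z • (e 2 + b t • e 1)) = z := by
  have h : t • e 0 + u • e 1 + z • (e 2 + b t • e 1) = shear e b ((t, z), u) := by
    simp only [shear]; module
  rw [h]
  exact inner_shear e b _

/-- Every line of the ruling lies inside the set or outside it, so the cutoff by A creates no
boundary terms. Fubini then turns the integral against the pulled-back form into -d_ε times that of
`partsIntegrand`, to which dominated convergence applies. -/
theorem hasInvariantLimit_shearWeight (e : OrthonormalBasis (Fin 3) ℝ K3) {b : ℝ → ℝ}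
    (hb : Measurable b) {B : ℝ} (hB : ∀ t, |b t| ≤ B) {A : Set (ℝ × ℝ)} (hA : MeasurableSet A)
    (hχ : ContDiff ℝ ∞ χ) (hc : HasCompactSupport χ) (hball : ∀ x ∈ tsupport χ, ‖x‖ ≤ 3)
    (htr : ∀ x ∈ tsupport χ, ∀ β : ℝ, |β| ≤ B → 3 / 4 ≤ |inner ℝ x (e 2 + β • e 1)|) :
    HasInvariantLimit (shearWeight e b A χ) := by
  set S := {x : K3 | (inner ℝ (e 0) x,
    inner ℝ (e 1) x - b (inner ℝ (e 0) x) * inner ℝ (e 2) x) ∈ A} with hSdef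
  have hS : MeasurableSet S := measurableSet_shear e hb hA
  set W : K3 → K3 := fun x => e 2 + b (inner ℝ (e 0) x) • e 1 with hWdef
  have hW : Measurable W := by
    have h : Measurable fun x : K3 => (inner ℝ (e 0) x : ℝ) :=
      (continuous_const.inner continuous_id).measurable
    exact ((hb.comp h).smul_const (e 1)).const_add (e 2)
  have hWn : ∀ x, ‖W x‖ ≤ 1 + B := by
    intro x
    refine (norm_add_le _ _).trans ?_
    rw [norm_smul, e.norm_eq_one, e.norm_eq_one, mul_one]
    exact add_le_add le_rfl (hB _)
  have hB0 : 0 ≤ B := (abs_nonneg _).trans (hB 0)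
  have hW0 : ∀ β : ℝ, e 2 + β • e 1 ≠ 0 := by
    intro β h
    have h1 := congrArg (inner ℝ (e 2)) h
    have h2 := orthonormal_iff_ite.1 e.orthonormal
    rw [inner_add_right, inner_smul_right, h2, h2] at h1
    simp at h1
  obtain ⟨D, hD⟩ := hc.exists_bound_of_continuous hχ.continuous
  have hm : Measurable (shearWeight e b A χ) := hχ.continuous.measurable.indicator hS
  have hbd : ∀ x, |shearWeight e b A χ x| ≤ D := fun x =>
    (norm_indicator_le_norm_self χ x).trans (hD x)
  -- The factor -1 is the limit of -d_ε.
  refine ⟨hm, ⟨D, hbd⟩, -1 * ∫ x, S.indicator (fun x => partsLimit χ x (W x)) x,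
    fun g hg => ?_⟩
  obtain ⟨bd, hbdi, hle⟩ := hg.exists_partsIntegrand_bound hχ hc hball
    (show 0 ≤ 1 + B by positivity)
  have hbound : ∀ᶠ ε : ℝ in 𝓝[>] 0,
      ∀ᵐ x, ‖S.indicator (fun x => partsIntegrand χ g ε x (W x)) x‖ ≤ bd x := by
    filter_upwards [hle] with ε hε
    filter_upwards [ae_norm_ne_one] with x hx
    exact (norm_indicator_le_norm_self _ _).trans
      (hε x (W x) (hWn x) hx fun h => htr x h _ (hB _))
  have hmeas : ∀ ε : ℝ,
      AEStronglyMeasurable (S.indicator fun x => partsIntegrand χ g ε x (W x)) volume :=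
    fun ε => ((measurable_partsIntegrand hχ hW g ε).indicator hS).aestronglyMeasurable
  have hlim : Tendsto (fun ε => ∫ x, S.indicator (fun x => partsIntegrand χ g ε x (W x)) x)
      (𝓝[>] 0) (𝓝 (∫ x, S.indicator (fun x => partsLimit χ x (W x)) x)) := by
    refine tendsto_integral_filter_of_dominated_convergence bd (.of_forall hmeas) hbound hbdi ?_
    filter_upwards [ae_norm_ne_one] with x hx
    by_cases hxS : x ∈ S
    · simp only [indicator_of_mem hxS]
      refine hg.tendsto_partsIntegrand hx fun hxs h0 => ?_
      have h1 := htr x hxs _ (hB (inner ℝ (e 0) x))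
      rw [hWdef] at h0
      rw [h0, abs_zero] at h1
      linarith
    · simp only [indicator_of_notMem hxS]
      exact tendsto_const_nhds
  obtain ⟨M, hM⟩ := exists_denomDeriv_bounds g (show 0 ≤ 1 + B by positivity)
  refine (tendsto_dEps.neg.mul hlim).congr' ?_
  filter_upwards [hbound, hM, self_mem_nhdsWithin] with ε hle hMε hε
  have hne : ∀ x ∈ tsupport χ, ∀ β : ℝ, |β| ≤ B → denomDeriv g ε x (e 2 + β • e 1) ≠ 0 := by
    intro x hx β hβ h0
    have h2 : ‖e 2 + β • e 1‖ ≤ 1 + B := by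
      refine (norm_add_le _ _).trans ?_
      rw [norm_smul, e.norm_eq_one, e.norm_eq_one, mul_one]
      exact add_le_add le_rfl hβ
    have := (hMε x _ (hball x hx) h2 (htr x hx β hβ)).1
    rw [h0, norm_zero] at this
    linarith
  have hFi : Integrable (S.indicator fun x => partsIntegrand χ g ε x (W x)) :=
    hbdi.mono' (hmeas ε) hle
  have hψi := integrable_weight_mul hm hbd g hε
  -- Dividing by d_ε leaves exactly χ / P² plus the logarithmic term, whose integral over each line
  -- vanishes.
  have hGi : Integrable fun x => (dEps ε)⁻¹ * (shearWeight e b A χ x * pullDensity g ε x) +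
      S.indicator (fun x => partsIntegrand χ g ε x (W x)) x := (hψi.const_mul _).add hFi
  have hG0 := integral_eq_zero_of_lines e hb hGi fun t u => by
    set y := t • e 0 + u • e 1
    by_cases htu : (t, u) ∈ A
    · have h0 : |b t| ≤ B := hB t
      refine Eq.trans ?_ (integral_line_eq_zero hg hχ hc hε (hW0 (b t))
        (fun x hx => hne x hx _ h0) y)
      refine integral_congr_ae (.of_forall fun z => ?_)
      obtain ⟨l1, l2, l3⟩ := shearWeight_apply_line (e := e) (b := b) t u z
      have hzS : y + z • (e 2 + b t • e 1) ∈ S := by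
        rw [hSdef, mem_ofPred_eq, l1, l2, l3, add_sub_cancel_right]
        exact htu
      have hWz : W (y + z • (e 2 + b t • e 1)) = e 2 + b t • e 1 := by
        simp only [hWdef]
        rw [l1]
      simp only [shearWeight]
      rw [indicator_of_mem hzS, indicator_of_mem hzS]
      simp only [hWz, pullDensity, partsIntegrand]
      congr 1
      field_simp [dEps_ne_zero ε]
    · refine integral_eq_zero_of_ae (.of_forall fun z => ?_)
      obtain ⟨l1, l2, l3⟩ := shearWeight_apply_line (e := e) (b := b) t u z
      have hzS : y + z • (e 2 + b t • e 1) ∉ S := by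
        rw [hSdef, mem_ofPred_eq, l1, l2, l3, add_sub_cancel_right]
        exact htu
      simp only [shearWeight]
      rw [indicator_of_notMem hzS, indicator_of_notMem hzS]
      simp
  rw [integral_add (hψi.const_mul _) hFi, integral_const_mul] at hG0
  have hd := dEps_ne_zero ε
  field_simp at hG0
  linear_combination -hG0

end

/-! ### Integrability over the cusp between surface and ruled surface -/

section

theorem integrable_indicator_abs_rpow {r : ℝ} (hr : -1 < r) (R : ℝ) :
    Integrable fun w : ℝ => (Iic R).indicator (fun s : ℝ => s ^ r) |w| := by
  have h := (integrable_fun_norm_addHaar (E := ℝ) volume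
    (f := (Iic R).indicator fun s : ℝ => s ^ r)).2 ?_
  · exact h
  · simp only [Module.finrank_self, tsub_self, pow_zero, one_smul]
    rw [integrableOn_indicator_iff measurableSet_Iic, inter_comm, Ioi_inter_Iic]
    rcases le_total 0 R with hR | hR
    · exact (intervalIntegrable_iff_integrableOn_Ioc_of_le hR).1
        (intervalIntegral.intervalIntegrable_rpow' hr)
    · simp [Ioc_eq_empty_of_le hR]

/-- The model of the region between a `C^{1,α}` curve and its tangent, weighted by the inverse
square of the distance. -/
def cuspWeight (C α : ℝ) (p : (ℝ × ℝ) × ℝ) : ℝ :=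
  (Icc (-2) 2).indicator (fun _ => (1 : ℝ)) p.1.1 *
    (Icc (-4) 4).indicator (fun w => (w ^ 2)⁻¹) p.1.2 *
    {q : ℝ × ℝ | |q.2| ≤ C * |q.1| ^ (1 + α)}.indicator (fun _ => (1 : ℝ)) (p.1.2, p.2)

theorem measurable_cuspWeight (C α : ℝ) : Measurable (cuspWeight C α) := by
  have h1 : Measurable ((Icc (-2) 2).indicator fun _ : ℝ => (1 : ℝ)) :=
    measurable_const.indicator measurableSet_Icc
  have h2 : Measurable ((Icc (-4) 4).indicator fun w : ℝ => (w ^ 2)⁻¹) :=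
    (by fun_prop : Measurable fun w : ℝ => (w ^ 2)⁻¹).indicator measurableSet_Icc
  have h3 : MeasurableSet {q : ℝ × ℝ | |q.2| ≤ C * |q.1| ^ (1 + α)} :=
    measurableSet_le (by fun_prop) (by fun_prop)
  have h4 : Measurable ({q : ℝ × ℝ | |q.2| ≤ C * |q.1| ^ (1 + α)}.indicator fun _ => (1 : ℝ)) :=
    measurable_const.indicator h3
  unfold cuspWeight
  fun_prop

/-- Integrating out the last variable leaves 2C |w|^(1+α) w⁻² = 2C |w|^(α-1) on a bounded range,
which is integrable because α > 0. -/
theorem integrable_cuspWeight {C α : ℝ} (hC : 0 ≤ C) (hα : 0 < α) :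
    Integrable (cuspWeight C α) := by
  have hm := (measurable_cuspWeight C α).aestronglyMeasurable (μ := volume)
  rw [Measure.volume_eq_prod] at hm ⊢
  have hin : ∀ w v : ℝ,
      {q : ℝ × ℝ | |q.2| ≤ C * |q.1| ^ (1 + α)}.indicator (fun _ => (1 : ℝ)) (w, v)
      = (Icc (-(C * |w| ^ (1 + α))) (C * |w| ^ (1 + α))).indicator (fun _ => (1 : ℝ)) v := by
    intro w v
    simp only [indicator, mem_ofPred_eq, mem_Icc, abs_le]
  have hI : ∀ w : ℝ, Integrable
      ((Icc (-(C * |w| ^ (1 + α))) (C * |w| ^ (1 + α))).indicator fun _ => (1 : ℝ)) := by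
    intro w
    rw [integrable_indicator_iff measurableSet_Icc]
    exact integrableOn_const (by simp)
  rw [integrable_prod_iff hm]
  constructor
  · refine .of_forall fun q => ?_
    simp only [cuspWeight, hin]
    exact (hI q.2).const_mul _
  · have h1 : Integrable ((Icc (-2) 2).indicator fun _ : ℝ => (1 : ℝ)) := by
      rw [integrable_indicator_iff measurableSet_Icc]
      exact integrableOn_const (by simp)
    have h2 := (integrable_indicator_abs_rpow (r := α - 1) (by linarith) 4).const_mul (2 * C)
    have h3 := h1.mul_prod h2
    refine h3.mono' hm.norm.integral_prod_right' (.of_forall fun q => ?_)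
    have h4 : ∀ v, ‖cuspWeight C α (q, v)‖ = (Icc (-2) 2).indicator (fun _ => (1 : ℝ)) q.1 *
        (Icc (-4) 4).indicator (fun w => (w ^ 2)⁻¹) q.2 *
        (Icc (-(C * |q.2| ^ (1 + α))) (C * |q.2| ^ (1 + α))).indicator (fun _ => (1 : ℝ)) v := by
      intro v
      rw [Real.norm_eq_abs, abs_of_nonneg]
      · simp only [cuspWeight, hin]
      · refine mul_nonneg (mul_nonneg ?_ ?_) ?_ <;>
          exact indicator_nonneg (fun _ _ => by positivity) _
    have h5 : 0 ≤ C * |q.2| ^ (1 + α) := by positivity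
    simp only [h4]
    rw [integral_const_mul, integral_indicator measurableSet_Icc]
    simp only [integral_const, smul_eq_mul, mul_one, MeasurableSet.univ, measureReal_restrict_apply,
      univ_inter, Real.volume_real_Icc]
    rw [max_eq_left (by linarith), Real.norm_eq_abs, abs_of_nonneg]
    · rw [mul_assoc]
      refine mul_le_mul_of_nonneg_left ?_ (indicator_nonneg (fun _ _ => zero_le_one) _)
      by_cases hw : q.2 ∈ Icc (-4 : ℝ) 4
      · have hw' : |q.2| ∈ Iic (4 : ℝ) := abs_le.2 hw
        rw [indicator_of_mem hw, indicator_of_mem hw']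
        -- At w = 0 the convention 0⁻¹ = 0 makes the left side vanish.
        rcases eq_or_ne q.2 0 with h0 | h0
        · rw [h0]
          simp only [ne_eq, OfNat.ofNat_ne_zero, not_false_eq_true, zero_pow, inv_zero, zero_mul]
          positivity
        · have h6 : 0 < |q.2| := abs_pos.2 h0
          have h7 : |q.2| ^ (1 + α) = |q.2| ^ (α - 1) * q.2 ^ 2 := by
            rw [← sq_abs q.2, ← Real.rpow_natCast, ← Real.rpow_add h6]
            congr 1
            push_cast
            ring
          rw [h7]
          apply le_of_eq
          field_simp
          ring
      · rw [indicator_of_notMem hw, zero_mul]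
        exact mul_nonneg (by positivity) (indicator_apply_nonneg fun _ => by positivity)
    · refine mul_nonneg (mul_nonneg ?_ ?_) (by linarith) <;>
        exact indicator_nonneg (fun _ _ => by positivity) _

/-- The points of `𝕂³` near the sphere which are too close to the surface
`s - b(t) z = c(t)`, in terms of the distance to its curve `z = z₀(t)`. -/
def cuspSet (e : OrthonormalBasis (Fin 3) ℝ K3) (b c z₀ : ℝ → ℝ) (C α : ℝ) : Set K3 :=
  {x | |(inner ℝ (e 0) x : ℝ)| ≤ 2 ∧ |(inner ℝ (e 2) x : ℝ)| ≤ 2 ∧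
    |inner ℝ (e 1) x - b (inner ℝ (e 0) x) * inner ℝ (e 2) x - c (inner ℝ (e 0) x)| ≤
      C * |inner ℝ (e 2) x - z₀ (inner ℝ (e 0) x)| ^ (1 + α)}

variable {b c z₀ : ℝ → ℝ}

theorem measurableSet_cuspSet (e : OrthonormalBasis (Fin 3) ℝ K3) (hb : Measurable b)
    (hc : Measurable c) (hz : Measurable z₀) (C α : ℝ) :
    MeasurableSet (cuspSet e b c z₀ C α) := by
  have h : ∀ i, Measurable fun x : K3 => (inner ℝ (e i) x : ℝ) := fun i =>
    (continuous_const.inner continuous_id).measurable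
  have h0 := h 0
  have h1 := h 1
  have h2 := h 2
  have hb' := hb.comp h0
  have hc' := hc.comp h0
  have hz' := hz.comp h0
  simp only [Function.comp_def] at hb' hc' hz'
  have k0 : MeasurableSet {x : K3 | |(inner ℝ (e 0) x : ℝ)| ≤ 2} :=
    measurableSet_le h0.abs measurable_const
  have k1 : MeasurableSet {x : K3 | |(inner ℝ (e 2) x : ℝ)| ≤ 2} :=
    measurableSet_le h2.abs measurable_const
  have k2 : Measurable fun x : K3 =>
      |inner ℝ (e 1) x - b (inner ℝ (e 0) x) * inner ℝ (e 2) x - c (inner ℝ (e 0) x)| := by fun_prop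
  have k3 : Measurable fun x : K3 =>
      C * |inner ℝ (e 2) x - z₀ (inner ℝ (e 0) x)| ^ (1 + α) := by fun_prop
  exact k0.inter (k1.inter (measurableSet_le k2 k3))

/-- The shear and the translations of z by z₀(t) and of u by c(t) preserve volume and reduce the
claim to `cuspWeight`. Its window of half-width 4 comes from |z| ≤ 2 and |z₀| ≤ 2. -/
theorem integrable_cuspSet (e : OrthonormalBasis (Fin 3) ℝ K3) (hb : Measurable b)
    (hc : Measurable c) (hz : Measurable z₀) (hz2 : ∀ t, |z₀ t| ≤ 2) {C α : ℝ} (hC : 0 ≤ C)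
    (hα : 0 < α) :
    Integrable ((cuspSet e b c z₀ C α).indicator fun x =>
      ((inner ℝ (e 2) x - z₀ (inner ℝ (e 0) x)) ^ 2)⁻¹) := by
  have hm := measurePreserving_shear e hb
  have he := measurableEmbedding_shear e hb
  rw [← hm.integrable_comp_emb he]
  have h1 : MeasurePreserving (fun q : ℝ × ℝ => (q.1, q.2 - z₀ q.1)) := by
    refine (MeasurePreserving.id (volume : Measure ℝ)).skew_product
      (g := fun t z => z - z₀ t) (by fun_prop) (.of_forall fun t => ?_)
    exact (measurePreserving_sub_right volume (z₀ t)).map_eq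
  have h2 : MeasurePreserving
      (fun p : (ℝ × ℝ) × ℝ => ((p.1.1, p.1.2 - z₀ p.1.1), p.2 - c p.1.1)) := by
    refine h1.skew_product (g := fun q u => u - c q.1) (by fun_prop) (.of_forall fun q => ?_)
    exact (measurePreserving_sub_right volume (c q.1)).map_eq
  have h3 := h2.integrable_comp_of_integrable (integrable_cuspWeight hC hα)
  refine h3.mono' ?_ (.of_forall fun p => ?_)
  · have h0 : Measurable fun x : K3 => (inner ℝ (e 0) x : ℝ) :=
      (continuous_const.inner continuous_id).measurable
    have h4 : Measurable fun x : K3 => (inner ℝ (e 2) x : ℝ) :=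
      (continuous_const.inner continuous_id).measurable
    have hz' := hz.comp h0
    simp only [Function.comp_def] at hz'
    have h5 : Measurable fun x : K3 => ((inner ℝ (e 2) x - z₀ (inner ℝ (e 0) x)) ^ 2)⁻¹ := by
      fun_prop
    exact ((h5.indicator (measurableSet_cuspSet e hb hc hz C α)).comp
      hm.measurable).aestronglyMeasurable
  · obtain ⟨i0, i1, i2⟩ := inner_shear e b p
    have hnn : 0 ≤ cuspWeight C α ((p.1.1, p.1.2 - z₀ p.1.1), p.2 - c p.1.1) := by
      refine mul_nonneg (mul_nonneg ?_ ?_) ?_ <;>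
        exact indicator_nonneg (fun _ _ => by positivity) _
    simp only [Function.comp_apply]
    by_cases hp : shear e b p ∈ cuspSet e b c z₀ C α
    · rw [indicator_of_mem hp]
      obtain ⟨k0, k2, k1⟩ := hp
      rw [i0] at k0
      rw [i2] at k2
      rw [i0, i1, i2, add_sub_cancel_right] at k1
      rw [i0, i2, Real.norm_eq_abs, abs_of_nonneg (by positivity), cuspWeight,
        indicator_of_mem (by exact abs_le.1 k0), indicator_of_mem, indicator_of_mem]
      · simp
      · exact k1
      · have := hz2 p.1.1
        rw [abs_le] at this k2
        constructor <;> simp only <;> linarith [k2.1, k2.2, this.1, this.2]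
    · rw [indicator_of_notMem hp, norm_zero]
      exact hnn

/-- A set that agrees near the sphere with a set invariant in the directions `e₂ + b(t) e₁`, up to
a set over which `(1 - |x|²)⁻²` is integrable, has an invariant limit locally. -/
theorem HasInvariantLimit.indicator_of_agrees {D M : Set K3} (hD : MeasurableSet D)
    (hMi : Integrable (M.indicator fun x => ((1 - ‖x‖ ^ 2) ^ 2)⁻¹))
    {χ : K3 → ℝ} {C : ℝ} (hC : ∀ x, |χ x| ≤ C) (hχ : Measurable χ)
    {e : OrthonormalBasis (Fin 3) ℝ K3} {A : Set (ℝ × ℝ)}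
    (hA : HasInvariantLimit (shearWeight e b A χ))
    (h : ∀ x ∈ tsupport χ, x ∉ M → (x ∈ D ↔ (inner ℝ (e 0) x,
      inner ℝ (e 1) x - b (inner ℝ (e 0) x) * inner ℝ (e 2) x) ∈ A)) :
    HasInvariantLimit (D.indicator χ) := by
  have hC0 : 0 ≤ C := (abs_nonneg _).trans (hC 0)
  have hbd : ∀ x, |D.indicator χ x - shearWeight e b A χ x| ≤ M.indicator (fun _ => 2 * C) x := by
    intro x
    have h1 : |D.indicator χ x| ≤ C := (norm_indicator_le_norm_self χ x).trans (hC x)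
    have h2 : |shearWeight e b A χ x| ≤ C := (norm_indicator_le_norm_self χ x).trans (hC x)
    by_cases hx : x ∈ M
    · rw [indicator_of_mem hx]
      exact (abs_sub _ _).trans (by linarith)
    · rw [indicator_of_notMem hx]
      by_cases hs : x ∈ tsupport χ
      · have h3 := h x hs hx
        have : D.indicator χ x = shearWeight e b A χ x := by
          by_cases hxD : x ∈ D
          · rw [indicator_of_mem hxD]
            refine Eq.symm (indicator_of_mem ?_ χ)
            exact h3.1 hxD
          · rw [indicator_of_notMem hxD]
            refine Eq.symm (indicator_of_notMem ?_ χ)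
            exact mt h3.2 hxD
        simp [this]
      · have h4 := image_eq_zero_of_notMem_tsupport hs
        simp [shearWeight, indicator, h4]
  have hm : Measurable fun x => D.indicator χ x - shearWeight e b A χ x :=
    (hχ.indicator hD).sub hA.1
  have hrest : HasInvariantLimit fun x => D.indicator χ x - shearWeight e b A χ x := by
    refine .of_integrable hm ⟨2 * C, fun x => (hbd x).trans ?_⟩ ?_
    · exact indicator_le_self' (fun _ _ => by positivity) x
    · refine (hMi.const_mul (2 * C)).mono' ?_ (.of_forall fun x => ?_)
      · have := hm.abs
        exact (this.div (by fun_prop)).aestronglyMeasurable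
      · rw [Real.norm_eq_abs, abs_of_nonneg (by positivity)]
        have h5 := hbd x
        by_cases hx : x ∈ M
        · rw [indicator_of_mem hx] at h5 ⊢
          rw [div_eq_mul_inv]
          gcongr
        · rw [indicator_of_notMem hx] at h5 ⊢
          rw [le_antisymm h5 (abs_nonneg _)]
          simp
  have := hA.add hrest
  simpa using this

end

/-! ### Local geometry at a point of the sphere -/

theorem exists_basis_of_norm_eq_one {p : K3} (hp : ‖p‖ = 1) :
    ∃ e : OrthonormalBasis (Fin 3) ℝ K3, e 2 = p := by
  have h : Orthonormal ℝ (({2} : Set (Fin 3)).domRestrict fun _ => p) := by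
    rw [orthonormal_subsingleton_iff]
    exact fun _ => hp
  obtain ⟨e, he⟩ := h.exists_orthonormalBasis_extension_of_card_eq (by simp)
  exact ⟨e, he 2 rfl⟩

/-- A tangent vector of the sphere not killed by L, with its sign adjusted and normalised, becomes
e₁; the normal p becomes e₂. -/
theorem exists_adapted_basis {p v : K3} (hp : ‖p‖ = 1) (hv : (inner ℝ p v : ℝ) = 0)
    {L : K3 →L[ℝ] ℝ} (hL : L v ≠ 0) :
    ∃ e : OrthonormalBasis (Fin 3) ℝ K3, e 2 = p ∧ 0 < L (e 1) := by
  obtain ⟨u, hu, hLu⟩ : ∃ u : K3, (inner ℝ p u : ℝ) = 0 ∧ 0 < L u := by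
    rcases lt_or_gt_of_ne hL with h | h
    · exact ⟨-v, by simp [hv], by simpa using h⟩
    · exact ⟨v, hv, h⟩
  have hu0 : u ≠ 0 := by rintro rfl; simp at hLu
  set w := ‖u‖⁻¹ • u
  have hw : ‖w‖ = 1 := norm_smul_inv_norm (𝕜 := ℝ) hu0
  have hpw : (inner ℝ p w : ℝ) = 0 := by simp [w, inner_smul_right, hu]
  have hwp : (inner ℝ w p : ℝ) = 0 := by rw [real_inner_comm, hpw]
  have h : Orthonormal ℝ (({1, 2} : Set (Fin 3)).domRestrict ![p, w, p]) := by
    constructor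
    · rintro ⟨i, hi⟩
      change ‖![p, w, p] i‖ = 1
      rcases (by simpa using hi : i = 1 ∨ i = 2) with rfl | rfl
      · exact hw
      · exact hp
    · rintro ⟨i, hi⟩ ⟨j, hj⟩ hij
      change (inner ℝ (![p, w, p] i) (![p, w, p] j) : ℝ) = 0
      rcases (by simpa using hi : i = 1 ∨ i = 2) with rfl | rfl <;>
        rcases (by simpa using hj : j = 1 ∨ j = 2) with rfl | rfl
      · exact absurd rfl hij
      · exact hwp
      · exact hpw
      · exact absurd rfl hij
  obtain ⟨e, he⟩ := h.exists_orthonormalBasis_extension_of_card_eq (by simp)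
  have he1 : e 1 = w := he 1 (by simp)
  have he2 : e 2 = p := he 2 (by simp)
  refine ⟨e, he2, ?_⟩
  rw [he1, map_smul, smul_eq_mul]
  have := norm_pos_iff.2 hu0
  positivity

theorem HolderOnWith.abs_sub_sub_fderiv_le {f : K3 → ℝ} {V s : Set K3} {C α : ℝ≥0}
    (hf : ∀ x ∈ V, DifferentiableAt ℝ f x) (hC : HolderOnWith C α (fderiv ℝ f) V)
    (hs : Convex ℝ s) (hsV : s ⊆ V) {x y : K3} (hx : x ∈ s) (hy : y ∈ s) :
    |f x - f y - fderiv ℝ f y (x - y)| ≤ C * ‖x - y‖ ^ (α : ℝ) * ‖x - y‖ := by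
  have hseg : segment ℝ y x ⊆ V := (hs.segment_subset hy hx).trans hsV
  refine (convex_segment y x).norm_image_sub_le_of_norm_hasFDerivWithin_le'
    (f' := fderiv ℝ f) (fun z hz => (hf z (hseg hz)).hasFDerivAt.hasFDerivWithinAt)
    (fun z hz => ?_) (left_mem_segment ℝ y x) (right_mem_segment ℝ y x)
  rw [← dist_eq_norm]
  refine (hC.dist_le (hseg hz) (hsV hy)).trans ?_
  have : dist z y ≤ ‖x - y‖ := by
    rw [← dist_eq_norm, dist_comm x y, dist_comm z y]
    exact (convex_closedBall y (dist y x)).segment_subset (by simp) (by simp [dist_comm]) hz |>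
      fun h => by simpa [dist_comm] using h
  gcongr

/-- An absorption argument: for small δ the hypothesis first gives |θ| ≤ δ/2, hence δ ≤ 2(B + 1)|d|,
and inserting this back replaces δ by |d| in the Hölder bound. -/
theorem abs_le_mul_rpow_of_le {m C α B θ d δ ρ : ℝ} (hm : 0 < m) (hC : 0 ≤ C) (hα : 0 < α)
    (hB : 0 ≤ B) (hδ0 : 0 ≤ δ) (hδ : δ ≤ |θ| + (B + 1) * |d|) (hδρ : δ ≤ 2 * ρ)
    (hρ : C * (2 * ρ) ^ α ≤ m / 4) (h : m / 2 * |θ| ≤ C * δ ^ α * δ) :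
    |θ| ≤ 2 * C / m * (2 * (B + 1)) ^ (1 + α) * |d| ^ (1 + α) := by
  have h1 : C * δ ^ α * δ ≤ m / 4 * δ := by
    gcongr
    exact (mul_le_mul_of_nonneg_left (Real.rpow_le_rpow hδ0 hδρ hα.le) hC).trans hρ
  have h2 : |θ| ≤ δ / 2 := by
    have : m * |θ| ≤ m * (δ / 2) := by linarith
    exact le_of_mul_le_mul_left this hm
  have h3 : δ ≤ 2 * (B + 1) * |d| := by linarith
  have h4 : C * δ ^ α * δ ≤ C * (2 * (B + 1) * |d|) ^ (1 + α) := by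
    rw [mul_assoc]
    gcongr
    have : δ ^ α * δ = δ ^ (1 + α) := by
      rw [add_comm, Real.rpow_add_one' hδ0 (by linarith)]
    rw [this]
    gcongr
  rw [Real.mul_rpow (by positivity) (abs_nonneg _)] at h4
  have h5 := h.trans h4
  have : |θ| = 2 / m * (m / 2 * |θ|) := by field_simp
  rw [this]
  calc 2 / m * (m / 2 * |θ|)
      ≤ 2 / m * (C * ((2 * (B + 1)) ^ (1 + α) * |d| ^ (1 + α))) := by gcongr
    _ = _ := by ring

/-- One has 1 - n = -(s - s₀)(s + s₀) - (z - z₀)(z + z₀). The second product is at least (3/2)|z -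
z₀| because z + z₀ is near 2, and the first is at most half of |z - z₀|. -/
theorem inv_sq_one_sub_le {ρ B n s s₀ z z₀ t : ℝ} (hB : 0 ≤ B) (hρ : 4 * ρ * (B + 1) ≤ 1)
    (hn : n = t ^ 2 + s ^ 2 + z ^ 2) (h0 : t ^ 2 + s₀ ^ 2 + z₀ ^ 2 = 1)
    (hs : |s - s₀| ≤ (B + 1) * |z - z₀|) (h1 : |s| ≤ ρ) (h2 : |s₀| ≤ ρ) (h3 : |z - 1| ≤ ρ)
    (h4 : |z₀ - 1| ≤ ρ) : ((1 - n) ^ 2)⁻¹ ≤ ((z - z₀) ^ 2)⁻¹ := by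
  have hρ0 : 0 ≤ ρ := (abs_nonneg _).trans h1
  have hQ : 1 - n = -((s - s₀) * (s + s₀)) - (z - z₀) * (z + z₀) := by rw [hn]; linarith
  -- For z = z₀ also s = s₀, and both inverses are 0 by convention.
  rcases eq_or_ne z z₀ with rfl | hz
  · rw [sub_self, abs_zero, mul_zero] at hs
    have : s - s₀ = 0 := abs_eq_zero.1 (le_antisymm hs (abs_nonneg _))
    rw [hQ, this]
    simp
  have hd : 0 < |z - z₀| := abs_pos.2 (sub_ne_zero.2 hz)
  have h5 : |(s - s₀) * (s + s₀)| ≤ (B + 1) * |z - z₀| * (2 * ρ) := by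
    rw [abs_mul]
    gcongr
    exact (abs_add_le _ _).trans (by linarith)
  have h6 : (2 - 2 * ρ) * |z - z₀| ≤ |(z - z₀) * (z + z₀)| := by
    rw [abs_mul, mul_comm]
    gcongr
    rw [abs_le] at h3 h4
    exact (by linarith [h3.1, h4.1] : 2 - 2 * ρ ≤ z + z₀).trans (le_abs_self _)
  have h7 : |z - z₀| ≤ |1 - n| := by
    have h8 : |(z - z₀) * (z + z₀)| ≤ |1 - n| + |(s - s₀) * (s + s₀)| := by
      rw [hQ]
      have := abs_add_le (-((s - s₀) * (s + s₀)) - (z - z₀) * (z + z₀)) ((s - s₀) * (s + s₀))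
      rw [show -((s - s₀) * (s + s₀)) - (z - z₀) * (z + z₀) + (s - s₀) * (s + s₀) =
        -((z - z₀) * (z + z₀)) by ring, abs_neg] at this
      exact this
    have h9 : 4 * ρ ≤ 1 := by nlinarith
    nlinarith
  rw [← sq_abs (z - z₀), ← sq_abs (1 - n)]
  gcongr

/-- Every smooth weight with compact support near `p`, cut off to `D`, has an invariant limit. -/
def IsLocallyInvariant (D : Set K3) (p : K3) : Prop :=
  ∃ N : Set K3, IsOpen N ∧ p ∈ N ∧ ∀ χ : K3 → ℝ, ContDiff ℝ ∞ χ → HasCompactSupport χ →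
    tsupport χ ⊆ N → HasInvariantLimit (D.indicator χ)

theorem abs_inner_le_of_mem_ball {p x : K3} {ρ : ℝ} (hx : x ∈ Metric.ball p ρ) {e : K3}
    (he : ‖e‖ = 1) : |(inner ℝ e x : ℝ) - inner ℝ e p| ≤ ρ := by
  rw [← inner_sub_right]
  refine (abs_real_inner_le_norm _ _).trans ?_
  rw [he, one_mul, ← dist_eq_norm]
  exact (Metric.mem_ball.1 hx).le

theorem inner_basis_mem_ball {e : OrthonormalBasis (Fin 3) ℝ K3} {p x : K3} (hep : e 2 = p) {ρ : ℝ}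
    (hx : x ∈ Metric.ball p ρ) : |(inner ℝ (e 0) x : ℝ)| ≤ ρ ∧ |(inner ℝ (e 1) x : ℝ)| ≤ ρ ∧
      |(inner ℝ (e 2) x : ℝ) - 1| ≤ ρ := by
  have h := orthonormal_iff_ite.1 e.orthonormal
  have h0 := abs_inner_le_of_mem_ball hx (e.norm_eq_one 0)
  have h1 := abs_inner_le_of_mem_ball hx (e.norm_eq_one 1)
  have h2 := abs_inner_le_of_mem_ball hx (e.norm_eq_one 2)
  rw [← hep, h] at h0 h1 h2
  simpa using And.intro h0 (And.intro h1 h2)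

/-- The e₂-term is at least 1 - ρ and the e₁-term at most Bρ in size, so 1 - ρ(B + 1) ≥ 3/4 remains.
-/
theorem le_abs_inner_of_mem_ball {e : OrthonormalBasis (Fin 3) ℝ K3} {p x : K3} (hep : e 2 = p)
    {ρ B : ℝ} (hx : x ∈ Metric.ball p ρ) (hρ : 4 * ρ * (B + 1) ≤ 1) {β : ℝ} (hβ : |β| ≤ B) :
    3 / 4 ≤ |(inner ℝ x (e 2 + β • e 1) : ℝ)| := by
  obtain ⟨-, h1, h2⟩ := inner_basis_mem_ball hep hx
  have hρ0 : 0 ≤ ρ := (abs_nonneg _).trans h1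
  rw [real_inner_comm, inner_add_left, real_inner_smul_left]
  have hB0 : 0 ≤ B := (abs_nonneg _).trans hβ
  have h3 : |β * inner ℝ (e 1) x| ≤ B * ρ := by rw [abs_mul]; gcongr
  refine le_trans ?_ (le_abs_self _)
  rw [abs_le] at h2 h3
  linarith [h2.1, h3.1]

theorem norm_le_of_mem_ball {p x : K3} (hp : ‖p‖ = 1) {ρ : ℝ} (hx : x ∈ Metric.ball p ρ)
    (hρ : ρ ≤ 1) : ‖x‖ ≤ 3 := by
  have h1 : ‖x - p‖ < ρ := mem_ball_iff_norm.1 hx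
  have h2 := norm_sub_norm_le x p
  linarith

/-- Near p the set is full or empty, hence trivially invariant along the lines in the direction e₂,
the case b = 0. -/
theorem isLocallyInvariant_of_notMem_frontier {D : Set K3} (hD : MeasurableSet D) {p : K3}
    (hp : ‖p‖ = 1) (hpD : p ∉ frontier D) : IsLocallyInvariant D p := by
  obtain ⟨e, he⟩ := exists_basis_of_norm_eq_one hp
  have hconst : ∃ N : Set K3, IsOpen N ∧ p ∈ N ∧ ∃ P : Prop, ∀ x ∈ N, (x ∈ D ↔ P) := by
    by_cases h : p ∈ interior D
    · exact ⟨interior D, isOpen_interior, h, True, fun x hx => by simp [interior_subset hx]⟩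
    · have h2 : p ∉ closure D := fun h3 => hpD ⟨h3, h⟩
      exact ⟨(closure D)ᶜ, isClosed_closure.isOpen_compl, h2, False,
        fun x hx => by simpa using fun h4 => hx (subset_closure h4)⟩
  obtain ⟨N, hN, hpN, P, hP⟩ := hconst
  refine ⟨N ∩ Metric.ball p (1 / 4), hN.inter Metric.isOpen_ball, ⟨hpN, by simp⟩,
    fun χ hχ hc hs => ?_⟩
  obtain ⟨C, hC⟩ := hc.exists_bound_of_continuous hχ.continuous
  have hA : MeasurableSet {_q : ℝ × ℝ | P} := MeasurableSet.const P
  have hsh := hasInvariantLimit_shearWeight e (b := fun _ => 0) measurable_const (B := 0) (by simp)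
    hA hχ hc (fun x hx => norm_le_of_mem_ball hp (hs hx).2 (by norm_num))
    (fun x hx β hβ => le_abs_inner_of_mem_ball he (hs hx).2 (by norm_num) hβ)
  refine HasInvariantLimit.indicator_of_agrees (M := ∅) hD (by simp) hC hχ.continuous.measurable
    hsh fun x hx _ => ?_
  simpa using hP x (hs hx).1

/-- Inverse function theorem: at p the differentials of ⟨e₀, x⟩ and 1 - |x|² have common kernel ℝe₁,
on which df does not vanish. -/
theorem exists_chart {e : OrthonormalBasis (Fin 3) ℝ K3} {p : K3} (hep : e 2 = p) {f : K3 → ℝ}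
    (hf : ContDiffAt ℝ 1 f p) (hm : fderiv ℝ f p (e 1) ≠ 0) :
    ∃ H : OpenPartialHomeomorph K3 (ℝ × ℝ × ℝ), p ∈ H.source ∧
      ∀ x, H x = (inner ℝ (e 0) x, f x, 1 - ‖x‖ ^ 2) := by
  have h1 : HasStrictFDerivAt (fun x : K3 => (inner ℝ (e 0) x : ℝ)) (innerSL ℝ (e 0)) p :=
    (innerSL ℝ (e 0)).hasStrictFDerivAt
  have h2 : HasStrictFDerivAt f (fderiv ℝ f p) p := hf.hasStrictFDerivAt (by simp)
  have h3 : HasStrictFDerivAt (fun x : K3 => 1 - ‖x‖ ^ 2) (-(2 • innerSL ℝ p)) p :=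
    (hasStrictFDerivAt_norm_sq p).const_sub 1
  set L : K3 →L[ℝ] ℝ × ℝ × ℝ :=
    (innerSL ℝ (e 0)).prod ((fderiv ℝ f p).prod (-(2 • innerSL ℝ p))) with hL
  have h4 : HasStrictFDerivAt (fun x : K3 => ((inner ℝ (e 0) x : ℝ), f x, 1 - ‖x‖ ^ 2)) L p :=
    h1.prodMk (h2.prodMk h3)
  have hinj : Function.Injective L.toLinearMap := by
    rw [← LinearMap.ker_eq_bot, LinearMap.ker_eq_bot']
    intro v hv
    have hv' : ((inner ℝ (e 0) v : ℝ), fderiv ℝ f p v, -(2 • (inner ℝ p v : ℝ))) = (0, 0, 0) := hv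
    simp only [Prod.mk.injEq] at hv'
    obtain ⟨k0, k1, k2⟩ := hv'
    have k3 : (inner ℝ (e 2) v : ℝ) = 0 := by rw [hep]; simpa using k2
    have hsum := e.sum_repr' v
    rw [Fin.sum_univ_three, k0, k3, zero_smul, zero_smul, zero_add, add_zero] at hsum
    rw [← hsum, map_smul, smul_eq_mul] at k1
    rw [← hsum, (mul_eq_zero.1 k1).resolve_right hm, zero_smul]
  let E : K3 ≃L[ℝ] ℝ × ℝ × ℝ :=
    (L.toLinearMap.linearEquivOfInjective hinj (by simp)).toContinuousLinearEquiv
  have hE : (E : K3 →L[ℝ] ℝ × ℝ × ℝ) = L := by ext1 v; rfl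
  rw [← hE] at h4
  exact ⟨h4.toOpenPartialHomeomorph _, h4.mem_toOpenPartialHomeomorph_source, fun x => rfl⟩

/-- N is a box in the chart (t, f, 1 - |x|²). There each side of f = 0 is convex, hence connected in
N, and γ is the axis (t, 0, 0), the intersection of the surface with the sphere. -/
theorem exists_box {e : OrthonormalBasis (Fin 3) ℝ K3} {p : K3} (hep : e 2 = p) {f : K3 → ℝ}
    (hf : ContDiffAt ℝ 1 f p) (hm : fderiv ℝ f p (e 1) ≠ 0) (hfp : f p = 0) {ρ : ℝ}
    (hρ : 0 < ρ) :
    ∃ (r : ℝ) (N : Set K3) (γ : ℝ → K3), IsOpen N ∧ p ∈ N ∧ N ⊆ Metric.ball p ρ ∧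
      IsPreconnected {x | x ∈ N ∧ 0 < f x} ∧ IsPreconnected {x | x ∈ N ∧ f x < 0} ∧
      ContinuousOn γ (Ioo (-r) r) ∧ (∀ x ∈ N, (inner ℝ (e 0) x : ℝ) ∈ Ioo (-r) r) ∧
      ∀ t ∈ Ioo (-r) r, γ t ∈ N ∧ (inner ℝ (e 0) (γ t) : ℝ) = t ∧ f (γ t) = 0 ∧
        ‖γ t‖ ^ 2 = 1 := by
  obtain ⟨H, hpH, hH⟩ := exists_chart hep hf hm
  have hp1 : ‖p‖ = 1 := by rw [← hep]; exact e.norm_eq_one 2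
  have hHp : H p = 0 := by
    have h := orthonormal_iff_ite.1 e.orthonormal 0 2
    rw [hH, hfp, hp1, ← hep, h]
    simp
  have hsymm : H.symm 0 = p := by rw [← hHp, H.left_inv hpH]
  have h0t : (0 : ℝ × ℝ × ℝ) ∈ H.target := hHp ▸ H.map_source hpH
  have hnhds : H.target ∩ H.symm ⁻¹' Metric.ball p ρ ∈ 𝓝 (0 : ℝ × ℝ × ℝ) :=
    (H.isOpen_inter_preimage_symm Metric.isOpen_ball).mem_nhds
      ⟨h0t, by simp [hsymm, hρ]⟩
  obtain ⟨r, hr, hball⟩ := Metric.mem_nhds_iff.1 hnhds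
  have hbox : ∀ y : ℝ × ℝ × ℝ, y ∈ Metric.ball (0 : ℝ × ℝ × ℝ) r ↔
      |y.1| < r ∧ |y.2.1| < r ∧ |y.2.2| < r := by
    intro y
    simp [Prod.norm_def]
  have himage : ∀ S : Set (ℝ × ℝ × ℝ), Convex ℝ S →
      IsPreconnected (H.symm '' (Metric.ball 0 r ∩ S)) := fun S hS =>
    ((convex_ball 0 r).inter hS).isPreconnected.image _
      (H.continuousOn_symm.mono fun y hy => (hball hy.1).1)
  have hset : ∀ s : Set ℝ, {x | x ∈ H.source ∩ H ⁻¹' Metric.ball 0 r ∧ f x ∈ s} =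
      H.symm '' (Metric.ball 0 r ∩ {y | y.2.1 ∈ s}) := by
    intro s
    ext x
    constructor
    · rintro ⟨⟨hx, hxb⟩, hxs⟩
      refine ⟨H x, ⟨hxb, ?_⟩, H.left_inv hx⟩
      change (H x).2.1 ∈ s
      rw [hH]
      exact hxs
    · rintro ⟨y, ⟨hyb, hys⟩, rfl⟩
      have hyt := (hball hyb).1
      refine ⟨⟨H.map_target hyt, ?_⟩, ?_⟩
      · rwa [mem_preimage, H.right_inv hyt]
      · have := congrArg (fun q => q.2.1) (H.right_inv hyt)
        rw [hH] at this
        change f (H.symm y) ∈ s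
        simp only at this
        rw [this]
        exact hys
  refine ⟨r, H.source ∩ H ⁻¹' Metric.ball 0 r, fun t => H.symm (t, 0, 0),
    H.isOpen_inter_preimage Metric.isOpen_ball, ⟨hpH, by simp [hHp, hr]⟩, ?_, ?_, ?_, ?_, ?_, ?_⟩
  · rintro x ⟨hx, hxb⟩
    have := (hball hxb).2
    rwa [mem_preimage, H.left_inv hx] at this
  · have := himage {y | y.2.1 ∈ Ioi (0 : ℝ)}
      ((convex_Ioi (0 : ℝ)).is_linear_preimage
        (f := fun y : ℝ × ℝ × ℝ => y.2.1)
        (LinearMap.fst ℝ ℝ ℝ ∘ₗ LinearMap.snd ℝ ℝ (ℝ × ℝ)).isLinear)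
    rw [← hset] at this
    exact this
  · have := himage {y | y.2.1 ∈ Iio (0 : ℝ)}
      ((convex_Iio (0 : ℝ)).is_linear_preimage
        (f := fun y : ℝ × ℝ × ℝ => y.2.1)
        (LinearMap.fst ℝ ℝ ℝ ∘ₗ LinearMap.snd ℝ ℝ (ℝ × ℝ)).isLinear)
    rw [← hset] at this
    exact this
  · refine H.continuousOn_symm.comp (by fun_prop) fun t ht => (hball ?_).1
    rw [hbox]
    simp [abs_lt, ht.1, ht.2, hr]
  · rintro x ⟨hx, hxb⟩
    have := (hbox _).1 hxb
    rw [hH] at this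
    exact abs_lt.1 this.1
  · intro t ht
    have hb : ((t, 0, 0) : ℝ × ℝ × ℝ) ∈ Metric.ball (0 : ℝ × ℝ × ℝ) r := by
      rw [hbox]
      simp [abs_lt, ht.1, ht.2, hr]
    have hyt := (hball hb).1
    have hri := H.right_inv hyt
    refine ⟨⟨H.map_target hyt, ?_⟩, ?_⟩
    · rwa [mem_preimage, hri]
    · rw [hH] at hri
      simp only [Prod.mk.injEq] at hri
      exact ⟨hri.1, hri.2.1, by linarith [hri.2.2]⟩

/-- Off the frontier, space is the disjoint union of the open sets `interior D` and `(closure D)ᶜ`,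
and a connected set meets only one of them. -/
theorem IsPreconnected.exists_forall_mem_iff {E D : Set K3} (hE : IsPreconnected E)
    (hED : Disjoint E (frontier D)) : ∃ P : Prop, ∀ x ∈ E, (x ∈ D ↔ P) := by
  have hcover : E ⊆ interior D ∪ (closure D)ᶜ := by
    intro x hx
    by_contra h
    simp only [mem_union, not_or, mem_compl_iff, not_not] at h
    exact disjoint_left.1 hED hx ⟨h.2, h.1⟩
  have hdisj : Disjoint (interior D) (closure D)ᶜ :=
    disjoint_compl_right_iff_subset.2 (interior_subset.trans subset_closure)
  by_cases h : (E ∩ interior D).Nonempty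
  · have := hE.subset_left_of_subset_union isOpen_interior isClosed_closure.isOpen_compl hdisj
      hcover h
    exact ⟨True, fun x hx => by simp [interior_subset (this hx)]⟩
  · refine ⟨False, fun x hx => ?_⟩
    rw [iff_false]
    rcases hcover hx with h1 | h1
    · exact absurd ⟨x, hx, h1⟩ h
    · exact fun h2 => h1 (subset_closure h2)

theorem ContinuousOn.measurable_indicator {f : ℝ → ℝ} {s : Set ℝ} (hf : ContinuousOn f s)
    (hs : MeasurableSet s) : Measurable (s.indicator f) := by
  classical
  rw [← piecewise_eq_indicator]
  exact ContinuousOn.measurable_piecewise hf continuousOn_const hs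

theorem exists_radius {p : K3} {f : K3 → ℝ} {V : Set K3} (hV : IsOpen V) (hpV : p ∈ V)
    (hcont : ContinuousOn (fderiv ℝ f) V) {m B C K α : ℝ} (hm : 0 < m) (hα : 0 < α) :
    ∃ ρ : ℝ, 0 < ρ ∧ Metric.ball p ρ ⊆ V ∧
      (∀ x ∈ Metric.ball p ρ, ‖fderiv ℝ f x - fderiv ℝ f p‖ ≤ m / 2) ∧
      4 * ρ * (B + 1) ≤ 1 ∧ C * (2 * ρ) ^ α ≤ m / 4 ∧ K * (2 * ρ) ^ α ≤ 1 ∧ ρ ≤ 1 := by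
  have hrpow : ∀ c : ℝ, Tendsto (fun ρ : ℝ => c * (2 * ρ) ^ α) (𝓝[>] 0) (𝓝 0) := by
    intro c
    have h : Continuous fun ρ : ℝ => c * (2 * ρ) ^ α :=
      continuous_const.mul ((continuous_const.mul continuous_id).rpow_const fun _ => Or.inr hα.le)
    have := (h.tendsto 0).mono_left (nhdsWithin_le_nhds (s := Ioi 0))
    simpa [Real.zero_rpow hα.ne'] using this
  have hlin : Tendsto (fun ρ : ℝ => 4 * ρ * (B + 1)) (𝓝[>] 0) (𝓝 0) := by
    have h : Continuous fun ρ : ℝ => 4 * ρ * (B + 1) := by fun_prop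
    simpa using (h.tendsto 0).mono_left (nhdsWithin_le_nhds (s := Ioi 0))
  have hnhds : V ∩ {x | dist (fderiv ℝ f x) (fderiv ℝ f p) < m / 2} ∈ 𝓝 p := by
    refine inter_mem (hV.mem_nhds hpV) ?_
    exact (hcont.continuousAt (hV.mem_nhds hpV)) (Metric.ball_mem_nhds _ (by positivity))
  obtain ⟨ρ₀, hρ₀, hsub⟩ := Metric.mem_nhds_iff.1 hnhds
  have hev := (hlin.eventually (ge_mem_nhds one_pos)).and
    (((hrpow C).eventually (ge_mem_nhds (show (0 : ℝ) < m / 4 by positivity))).and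
    (((hrpow K).eventually (ge_mem_nhds one_pos)).and
      (Ioo_mem_nhdsGT (show (0 : ℝ) < min ρ₀ 1 by positivity))))
  obtain ⟨ρ, h1, h2, h3, h4, h5⟩ := hev.exists
  have hball := (Metric.ball_subset_ball (h5.le.trans (min_le_left _ _))).trans hsub
  exact ⟨ρ, h4, fun x hx => (hball hx).1, fun x hx => by
    rw [← dist_eq_norm]; exact (hball hx).2.le, h1, h2, h3, h5.le.trans (min_le_right _ _)⟩

theorem sub_eq_of_inner_eq (e : OrthonormalBasis (Fin 3) ℝ K3) {x y : K3}
    (h : (inner ℝ (e 0) x : ℝ) = inner ℝ (e 0) y) :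
    x - y = (inner ℝ (e 1) x - inner ℝ (e 1) y : ℝ) • e 1 +
      (inner ℝ (e 2) x - inner ℝ (e 2) y : ℝ) • e 2 := by
  rw [← e.sum_repr' (x - y), Fin.sum_univ_three, inner_sub_right, inner_sub_right, inner_sub_right,
    h, sub_self, zero_smul, zero_add]

theorem norm_sq_eq_sum (e : OrthonormalBasis (Fin 3) ℝ K3) (x : K3) :
    ‖x‖ ^ 2 = (inner ℝ (e 0) x : ℝ) ^ 2 + (inner ℝ (e 1) x : ℝ) ^ 2 +
      (inner ℝ (e 2) x : ℝ) ^ 2 := by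
  rw [← e.sum_sq_norm_inner_right x, Fin.sum_univ_three]
  simp only [Real.norm_eq_abs, sq_abs]

/-- Compare x with the point y = γ(t) of its slice. The vector e₂ + b(t) e₁ is in the kernel of
df_y, so df_y(x - y) = df_y(e₁) θ, where θ is the e₁-offset of x from the tangent line. Outside the
cusp this term beats the Hölder remainder, so f(x) has the sign of θ, and membership in D depends on
that sign alone. -/
theorem isLocallyInvariant_of_mem_frontier {α : ℝ≥0} (hα : 0 < α) {D : Set K3}
    (hD : MeasurableSet D) {p : K3} (hp : ‖p‖ = 1) {V : Set K3} (hV : IsOpen V) (hpV : p ∈ V)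
    {f : K3 → ℝ} (hf : IsC1Holder α f V) (hfr : frontier D ∩ V = {x | x ∈ V ∧ f x = 0})
    (hfp : f p = 0) (htr : IsTransversalAt f p) : IsLocallyInvariant D p := by
  obtain ⟨v, hv, hL⟩ := htr
  obtain ⟨e, hep, hm⟩ := exists_adapted_basis hp hv hL
  obtain ⟨hf1, CH, hCH⟩ := hf
  set m := fderiv ℝ f p (e 1) with hmdef
  have hdiff : ∀ x ∈ V, DifferentiableAt ℝ f x := fun x hx =>
    (hf1.contDiffAt (hV.mem_nhds hx)).differentiableAt (by simp)
  have hcont : ContinuousOn (fderiv ℝ f) V := hf1.continuousOn_fderiv_of_isOpen hV le_rfl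
  set L := ‖fderiv ℝ f p‖
  -- Bounds the slope b, as |df(e₂)| ≤ L + m/2 and df(e₁) ≥ m/2 on the ball of radius ρ chosen
  -- below.
  set B := (L + m / 2) / (m / 2) with hBdef
  have hB : 0 ≤ B := by positivity
  set K : ℝ := 2 * CH / m * (2 * (B + 1)) ^ (1 + (α : ℝ))
  have hK : 0 ≤ K := by positivity
  have hα' : (0 : ℝ) < α := by exact_mod_cast hα
  obtain ⟨ρ, hρ, hρV, hρd, hρB, hρC, hρK, hρ1⟩ :=
    exists_radius (B := B) (C := CH) (K := K) (α := α) hV hpV hcont hm hα'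
  obtain ⟨r, N, γ, hN, hpN, hNρ, hpos, hneg, hγc, hNr, hγ⟩ :=
    exists_box hep (hf1.contDiffAt (hV.mem_nhds hpV)) hm.ne' hfp hρ
  have hNV : N ⊆ V := hNρ.trans hρV
  have hd1 : ∀ x ∈ N, m / 2 ≤ fderiv ℝ f x (e 1) := by
    intro x hx
    have h := ContinuousLinearMap.le_of_opNorm_le _ (hρd x (hNρ hx)) (e 1)
    rw [e.norm_eq_one, mul_one, sub_apply, Real.norm_eq_abs] at h
    linarith [(abs_le.1 h).1]
  have hd2 : ∀ x ∈ N, |fderiv ℝ f x (e 2)| ≤ L + m / 2 := by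
    intro x hx
    have h := ContinuousLinearMap.le_of_opNorm_le _ (hρd x (hNρ hx)) (e 2)
    have h2 := (fderiv ℝ f p).le_opNorm (e 2)
    rw [e.norm_eq_one, mul_one, sub_apply, Real.norm_eq_abs] at h
    rw [e.norm_eq_one, mul_one, Real.norm_eq_abs] at h2
    have := abs_sub_abs_le_abs_sub (fderiv ℝ f x (e 2)) (fderiv ℝ f p (e 2))
    linarith
  set s := Ioo (-r) r
  -- The slope of the tangent line at γ(t), the height z₀ of γ(t) and the intercept c of the line;
  -- extension by 0 outside the interval keeps them measurable.
  set b : ℝ → ℝ := s.indicator fun t => -(fderiv ℝ f (γ t) (e 2) / fderiv ℝ f (γ t) (e 1)) with hb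
  set z₀ : ℝ → ℝ := s.indicator fun t => inner ℝ (e 2) (γ t) with hz₀
  set c : ℝ → ℝ := s.indicator fun t => inner ℝ (e 1) (γ t) -
    -(fderiv ℝ f (γ t) (e 2) / fderiv ℝ f (γ t) (e 1)) * inner ℝ (e 2) (γ t) with hc
  have hγV : MapsTo γ s V := fun t ht => hNV (hγ t ht).1
  have hγd : ∀ w : K3, ContinuousOn (fun t => fderiv ℝ f (γ t) w) s := fun w =>
    (hcont.comp hγc hγV).clm_apply continuousOn_const
  have hγi : ∀ w : K3, ContinuousOn (fun t => (inner ℝ w (γ t) : ℝ)) s := fun w =>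
    continuousOn_const.inner hγc
  have hbc : ContinuousOn (fun t => -(fderiv ℝ f (γ t) (e 2) / fderiv ℝ f (γ t) (e 1))) s :=
    ((hγd _).div (hγd _) fun t ht =>
      ((half_pos hm).trans_le (hd1 _ (hγ t ht).1)).ne').neg
  have hbm : Measurable b := ContinuousOn.measurable_indicator hbc measurableSet_Ioo
  have hzm : Measurable z₀ := ContinuousOn.measurable_indicator (hγi _) measurableSet_Ioo
  have hcm : Measurable c := ContinuousOn.measurable_indicator
    ((hγi _).sub (hbc.mul (hγi _))) measurableSet_Ioo
  have hbB : ∀ t, |b t| ≤ B := by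
    intro t
    by_cases ht : t ∈ s
    · rw [hb, indicator_of_mem ht, abs_neg, abs_div, hBdef]
      have h1 := hd1 _ (hγ t ht).1
      gcongr
      · exact hd2 _ (hγ t ht).1
      · exact h1.trans (le_abs_self _)
    · rwa [hb, indicator_of_notMem ht, abs_zero]
  have hz2 : ∀ t, |z₀ t| ≤ 2 := by
    intro t
    by_cases ht : t ∈ s
    · have h1 := (inner_basis_mem_ball hep (hNρ (hγ t ht).1)).2.2
      rw [hz₀, indicator_of_mem ht]
      rw [abs_le] at h1 ⊢
      constructor <;> linarith [h1.1, h1.2]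
    · rw [hz₀, indicator_of_notMem ht, abs_zero]
      norm_num
  have hbz : ∀ x ∈ N, ∃ y ∈ N, (inner ℝ (e 0) x : ℝ) = inner ℝ (e 0) y ∧ f y = 0 ∧ ‖y‖ ^ 2 = 1 ∧
      b (inner ℝ (e 0) x) = -(fderiv ℝ f y (e 2) / fderiv ℝ f y (e 1)) ∧
      z₀ (inner ℝ (e 0) x) = inner ℝ (e 2) y ∧
      c (inner ℝ (e 0) x) = inner ℝ (e 1) y - b (inner ℝ (e 0) x) * inner ℝ (e 2) y := by
    intro x hx
    have ht := hNr x hx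
    obtain ⟨h1, h2, h3, h4⟩ := hγ _ ht
    exact ⟨_, h1, h2.symm, h3, h4, indicator_of_mem ht _, indicator_of_mem ht _,
      by rw [hc, hb, indicator_of_mem ht, indicator_of_mem ht]⟩
  have hNbounds : ∀ x ∈ N, |(inner ℝ (e 0) x : ℝ)| ≤ 2 ∧ |(inner ℝ (e 2) x : ℝ)| ≤ 2 := by
    intro x hx
    obtain ⟨h1, -, h3⟩ := inner_basis_mem_ball hep (hNρ hx)
    rw [abs_le] at h3
    exact ⟨h1.trans (by linarith), abs_le.2 ⟨by linarith [h3.1], by linarith [h3.2]⟩⟩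
  have hfrE : ∀ E ⊆ N, (∀ x ∈ E, f x ≠ 0) → Disjoint E (frontier D) := by
    intro E hE hE0
    refine disjoint_left.2 fun x hx hxf => hE0 x hx ?_
    have : x ∈ frontier D ∩ V := ⟨hxf, hNV (hE hx)⟩
    rw [hfr] at this
    exact this.2
  -- P₁ and P₂ record whether D fills the sides f > 0 and f < 0. They are independent: D may lie on
  -- both sides or on neither.
  obtain ⟨P₁, hP₁⟩ := IsPreconnected.exists_forall_mem_iff hpos
    (hfrE _ (fun x hx => hx.1) fun x hx => hx.2.ne')
  obtain ⟨P₂, hP₂⟩ := IsPreconnected.exists_forall_mem_iff hneg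
    (hfrE _ (fun x hx => hx.1) fun x hx => hx.2.ne)
  refine ⟨N, hN, hpN, fun χ hχ hχc hχN => ?_⟩
  obtain ⟨Cχ, hCχ⟩ := hχc.exists_bound_of_continuous hχ.continuous
  set A : Set (ℝ × ℝ) := {q | (P₁ ∧ c q.1 < q.2) ∨ (P₂ ∧ q.2 < c q.1)} with hAdef
  have hA : MeasurableSet A := by
    have h1 : MeasurableSet {q : ℝ × ℝ | c q.1 < q.2} :=
      measurableSet_lt (by fun_prop) (by fun_prop)
    have h2 : MeasurableSet {q : ℝ × ℝ | q.2 < c q.1} :=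
      measurableSet_lt (by fun_prop) (by fun_prop)
    exact ((MeasurableSet.const P₁).inter h1).union ((MeasurableSet.const P₂).inter h2)
  have hsh := hasInvariantLimit_shearWeight e hbm hbB hA hχ hχc
    (fun x hx => norm_le_of_mem_ball hp (hNρ (hχN hx)) hρ1)
    (fun x hx β hβ => le_abs_inner_of_mem_ball hep (hNρ (hχN hx)) hρB hβ)
  have hcusp := integrable_cuspSet e hbm hcm hzm hz2 hK hα'
  have hcuspm := measurableSet_cuspSet e hbm hcm hzm K α
  refine HasInvariantLimit.indicator_of_agrees (M := N ∩ cuspSet e b c z₀ K α) hD ?_ hCχ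
    hχ.continuous.measurable hsh fun x hx hxM => ?_
  -- On the cusp |s - s₀| ≤ (B + 1)|d|, since K|d|^(1+α) ≤ |d| for |d| ≤ 2ρ; hence (1 - |x|²)⁻² ≤
  -- d⁻².
  · refine hcusp.mono' ?_ (.of_forall fun x => ?_)
    · exact (Measurable.indicator (by fun_prop)
        (hN.measurableSet.inter hcuspm)).aestronglyMeasurable
    · by_cases hx : x ∈ N ∩ cuspSet e b c z₀ K α
      · rw [indicator_of_mem hx]
        obtain ⟨hxN, hxc⟩ := hx
        rw [ indicator_of_mem hxc, Real.norm_eq_abs,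
          abs_of_nonneg (by positivity)]
        obtain ⟨y, hyN, hxy, hfy, hy1, hby, hzy, hcy⟩ := hbz x hxN
        obtain ⟨-, hx1, hx2⟩ := inner_basis_mem_ball hep (hNρ hxN)
        obtain ⟨-, hy1', hy2⟩ := inner_basis_mem_ball hep (hNρ hyN)
        have h3 := hxc.2.2
        rw [hcy, hzy] at h3
        rw [hzy]
        rw [norm_sq_eq_sum e, ← hxy] at hy1
        refine inv_sq_one_sub_le hB hρB (norm_sq_eq_sum e x) hy1 ?_ hx1 hy1' hx2 hy2
        set d := (inner ℝ (e 2) x : ℝ) - inner ℝ (e 2) y with hd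
        have hd2ρ : |d| ≤ 2 * ρ := by
          rw [abs_le] at hx2 hy2 ⊢
          constructor <;> linarith [hx2.1, hx2.2, hy2.1, hy2.2]
        have h4 : K * |d| ^ (1 + (α : ℝ)) ≤ |d| := by
          rw [add_comm, Real.rpow_add_one' (abs_nonneg _) (by positivity), ← mul_assoc]
          have : K * |d| ^ (α : ℝ) ≤ 1 :=
            (mul_le_mul_of_nonneg_left (Real.rpow_le_rpow (abs_nonneg _) hd2ρ hα'.le) hK).trans hρK
          exact mul_le_of_le_one_left (abs_nonneg _) this
        have h5 : |b (inner ℝ (e 0) x) * d| ≤ B * |d| := by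
          rw [abs_mul]; gcongr; exact hbB _
        have h6 : (inner ℝ (e 1) x : ℝ) - inner ℝ (e 1) y =
            (inner ℝ (e 1) x - b (inner ℝ (e 0) x) * inner ℝ (e 2) x -
              (inner ℝ (e 1) y - b (inner ℝ (e 0) x) * inner ℝ (e 2) y)) +
              b (inner ℝ (e 0) x) * d := by rw [hd]; ring
        rw [h6]
        refine (abs_add_le _ _).trans ?_
        linarith
      · rw [indicator_of_notMem hx, norm_zero]
        exact indicator_nonneg (fun _ _ => by positivity) _
  · have hxN := hχN hx
    obtain ⟨y, hyN, hxy, hfy, hy1, hby, hzy, hcy⟩ := hbz x hxN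
    set θ := inner ℝ (e 1) x - b (inner ℝ (e 0) x) * inner ℝ (e 2) x - c (inner ℝ (e 0) x) with hθ
    set d := (inner ℝ (e 2) x : ℝ) - inner ℝ (e 2) y with hd
    have hnot : ¬ |θ| ≤ K * |d| ^ (1 + (α : ℝ)) := by
      intro h
      refine hxM ⟨hxN, (hNbounds x hxN).1, (hNbounds x hxN).2, ?_⟩
      rw [hzy]
      exact h
    have hds : (inner ℝ (e 1) x : ℝ) - inner ℝ (e 1) y = θ + b (inner ℝ (e 0) x) * d := by
      rw [hθ, hd, hcy]; ring
    have hsub := sub_eq_of_inner_eq e hxy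
    rw [hds, ← hd] at hsub
    have hδ : ‖x - y‖ ≤ |θ| + (B + 1) * |d| := by
      rw [hsub]
      refine (norm_add_le _ _).trans ?_
      rw [norm_smul, norm_smul, e.norm_eq_one, e.norm_eq_one, mul_one, mul_one, Real.norm_eq_abs,
        Real.norm_eq_abs]
      have h1 := abs_add_le θ (b (inner ℝ (e 0) x) * d)
      have h2 : |b (inner ℝ (e 0) x) * d| ≤ B * |d| := by
        rw [abs_mul]; gcongr; exact hbB _
      linarith
    have hδρ : ‖x - y‖ ≤ 2 * ρ := by
      have h1 := Metric.mem_ball.1 (hNρ hxN)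
      have h2 := Metric.mem_ball.1 (hNρ hyN)
      rw [← dist_eq_norm]
      linarith [dist_triangle_right x y p]
    have hy1' := hd1 y hyN
    have hlin : fderiv ℝ f y (x - y) = fderiv ℝ f y (e 1) * θ := by
      have : fderiv ℝ f y (e 1) ≠ 0 := by linarith
      rw [hsub, map_add, map_smul, map_smul, smul_eq_mul, smul_eq_mul, hby]
      field_simp
      ring
    have hTaylor := HolderOnWith.abs_sub_sub_fderiv_le hdiff hCH (convex_ball p ρ) hρV
      (hNρ hxN) (hNρ hyN)
    rw [hfy, hlin, sub_zero] at hTaylor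
    -- Outside the cusp the remainder is less than m|θ|/2, so the linear term decides the sign of
    -- f(x).
    have hbig : ¬ m / 2 * |θ| ≤ CH * ‖x - y‖ ^ (α : ℝ) * ‖x - y‖ := fun h =>
      hnot (abs_le_mul_rpow_of_le hm CH.coe_nonneg hα' hB (norm_nonneg _) hδ hδρ hρC h)
    have hθ0 : θ ≠ 0 := by
      intro h0
      apply hnot
      rw [h0, abs_zero]
      positivity
    rcases lt_or_gt_of_ne hθ0 with hlt | hgt
    · have hfx : f x < 0 := by
        by_contra! hfx
        apply hbig
        rw [abs_of_neg hlt]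
        refine le_trans ?_ ((le_abs_self _).trans hTaylor)
        linarith [mul_le_mul_of_nonpos_right hy1' hlt.le]
      rw [hP₂ x ⟨hxN, hfx⟩]
      have h1 : ¬ c (inner ℝ (e 0) x) <
          inner ℝ (e 1) x - b (inner ℝ (e 0) x) * inner ℝ (e 2) x := by linarith
      have h2 : inner ℝ (e 1) x - b (inner ℝ (e 0) x) * inner ℝ (e 2) x <
        c (inner ℝ (e 0) x) := by linarith
      simp [hAdef, h1, h2]
    · have hfx : 0 < f x := by
        by_contra! hfx
        apply hbig
        rw [abs_of_pos hgt]
        refine le_trans ?_ ((neg_le_abs _).trans hTaylor)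
        linarith [mul_le_mul_of_nonneg_right hy1' hgt.le]
      rw [hP₁ x ⟨hxN, hfx⟩]
      have h1 : c (inner ℝ (e 0) x) <
          inner ℝ (e 1) x - b (inner ℝ (e 0) x) * inner ℝ (e 2) x := by linarith
      have h2 : ¬ inner ℝ (e 1) x - b (inner ℝ (e 0) x) * inner ℝ (e 2) x <
        c (inner ℝ (e 0) x) := by linarith
      simp [hAdef, h1, h2]

/-! ### From local to global -/

theorem integrableOn_inv_sq_one_sub {η : ℝ} (hη : 0 < η) :
    IntegrableOn (fun x : K3 => ((1 - ‖x‖ ^ 2) ^ 2)⁻¹) {x | η ≤ |1 - ‖x‖|} := by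
  have hS : MeasurableSet {x : K3 | η ≤ |1 - ‖x‖|} := measurableSet_le (by fun_prop) (by fun_prop)
  have h1 : Integrable (fun x : K3 => (1 + ‖x‖ ^ 2) ^ (-(4 : ℝ) / 2)) :=
    integrable_rpow_neg_one_add_norm_sq (by simp; norm_num)
  refine Integrable.mono' (h1.integrableOn.const_mul ((1 + 2 / η) ^ 2))
    (by fun_prop) ((ae_restrict_iff' hS).2 (.of_forall fun x hx => ?_))
  have h2 : (1 + ‖x‖ ^ 2) ^ (-(4 : ℝ) / 2) = ((1 + ‖x‖ ^ 2) ^ 2)⁻¹ := by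
    rw [show -(4 : ℝ) / 2 = -((2 : ℕ) : ℝ) by norm_num, Real.rpow_neg (by positivity),
      Real.rpow_natCast]
  have hx' : η ≤ |1 - ‖x‖| := hx
  have hn := norm_nonneg x
  have h3 : |1 - ‖x‖ ^ 2| = |1 - ‖x‖| * (1 + ‖x‖) := by
    rw [show 1 - ‖x‖ ^ 2 = (1 - ‖x‖) * (1 + ‖x‖) by ring, abs_mul,
      abs_of_pos (show 0 < 1 + ‖x‖ by positivity)]
  -- Combine 1 + |x|² ≤ 2 + |1 - |x|²| with |1 - |x|²| ≥ η.
  have h4 : 1 + ‖x‖ ^ 2 ≤ (1 + 2 / η) * |1 - ‖x‖ ^ 2| := by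
    have h5 : η ≤ |1 - ‖x‖ ^ 2| := by rw [h3]; nlinarith [abs_nonneg (1 - ‖x‖)]
    have h6 : 2 ≤ 2 / η * |1 - ‖x‖ ^ 2| := by
      rw [div_mul_eq_mul_div, le_div_iff₀ hη]; linarith
    have h7 := neg_abs_le (1 - ‖x‖ ^ 2)
    linarith
  have h8 : 0 < |1 - ‖x‖ ^ 2| := by
    rw [h3]; have : 0 < |1 - ‖x‖| := hη.trans_le hx'
    positivity
  rw [h2, Real.norm_eq_abs, abs_of_nonneg (by positivity), ← sq_abs (1 - ‖x‖ ^ 2),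
    ← div_eq_mul_inv, le_div_iff₀ (by positivity), ← div_eq_inv_mul, div_le_iff₀ (by positivity),
    ← mul_pow]
  gcongr

theorem le_abs_one_sub_norm_of_notMem_cthickening {η : ℝ} {x : K3}
    (hx : x ∉ Metric.cthickening η boundaryH) : η ≤ |1 - ‖x‖| := by
  by_contra! h
  apply hx
  rcases eq_or_ne x 0 with rfl | h0
  · refine Metric.mem_cthickening_of_dist_le _ (EuclideanSpace.single 0 1) _ _ ?_ ?_
    · simp [boundaryH]
    · simpa using h.le
  · refine Metric.mem_cthickening_of_dist_le _ (‖x‖⁻¹ • x) _ _ ?_ ?_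
    · rw [boundaryH, mem_sphere_zero_iff_norm]
      exact norm_smul_inv_norm (𝕜 := ℝ) h0
    · have h1 := norm_pos_iff.2 h0
      have h2 : x - ‖x‖⁻¹ • x = (1 - ‖x‖⁻¹) • x := by module
      rw [dist_eq_norm, h2, norm_smul, Real.norm_eq_abs]
      have h3 : |1 - ‖x‖⁻¹| * ‖x‖ = |1 - ‖x‖| := by
        nth_rewrite 2 [← abs_norm x]
        rw [← abs_mul, sub_mul, inv_mul_cancel₀ h1.ne', one_mul, abs_sub_comm]
      rw [h3]
      exact h.le

/-- By compactness, finitely many good neighbourhoods cover a closed thickening of the sphere. A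
subordinate smooth partition of unity sums to 1 there, and the remaining weight lives where (1 -
|x|²)⁻² is integrable. -/
theorem hasInvariantLimit_indicator {D : Set K3} (hD : MeasurableSet D)
    (h : ∀ p ∈ boundaryH, IsLocallyInvariant D p) :
    HasInvariantLimit (D.indicator fun _ => 1) := by
  choose! N hN hpN hχN using h
  have hScpt : IsCompact boundaryH := isCompact_sphere 0 1
  obtain ⟨T, hT⟩ := hScpt.elim_nhds_subcover' (fun p _ => N p ∩ Metric.ball p 1)
    fun p hp => ((hN p hp).inter Metric.isOpen_ball).mem_nhds ⟨hpN p hp, by simp⟩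
  set W : T → Set K3 := fun i => N i.1 ∩ Metric.ball i.1 1 with hWdef
  have hWo : ∀ i, IsOpen (W i) := fun i => (hN i.1 i.1.2).inter Metric.isOpen_ball
  have hcover : boundaryH ⊆ ⋃ i, W i := by
    refine hT.trans fun x hx => ?_
    obtain ⟨p, hp, hxp⟩ := mem_iUnion₂.1 hx
    exact mem_iUnion.2 ⟨⟨p, hp⟩, hxp⟩
  obtain ⟨η, hη, hηW⟩ := hScpt.exists_cthickening_subset_open (isOpen_iUnion hWo) hcover
  obtain ⟨f, hf⟩ := SmoothPartitionOfUnity.exists_isSubordinate 𝓘(ℝ, K3)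
    (Metric.isClosed_cthickening (δ := η) (E := boundaryH)) W hWo hηW
  have hsmooth : ∀ i, ContDiff ℝ ∞ (f i) := fun i => (f i).contMDiff.contDiff
  have hcpt : ∀ i, HasCompactSupport (f i) := fun i =>
    (isCompact_closedBall (i.1 : K3) 1).of_isClosed_subset (isClosed_tsupport _)
      ((hf i).trans (inter_subset_right.trans Metric.ball_subset_closedBall))
  have hloc : HasInvariantLimit fun x => ∑ i, D.indicator (f i) x :=
    HasInvariantLimit.sum _ fun i _ =>
      hχN i.1 i.1.2 (f i) (hsmooth i) (hcpt i) ((hf i).trans inter_subset_left)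
  have hsum1 : ∀ x, ∑ i, f i x ≤ 1 := fun x => by
    rw [← finsum_eq_sum_of_fintype]; exact f.sum_le_one x
  have hsum0 : ∀ x, 0 ≤ ∑ i, f i x := fun x => Finset.sum_nonneg fun i _ => f.nonneg i x
  have hsum : ∀ x ∈ Metric.cthickening η boundaryH, ∑ i, f i x = 1 := fun x hx => by
    rw [← finsum_eq_sum_of_fintype]; exact f.sum_eq_one hx
  have hm : Measurable (D.indicator fun x => 1 - ∑ i, f i x) :=
    (measurable_const.sub (Finset.measurable_sum _ fun i _ =>
      (hsmooth i).continuous.measurable)).indicator hD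
  have hbd : ∀ x, |D.indicator (fun x => 1 - ∑ i, f i x) x| ≤
      {x : K3 | η ≤ |1 - ‖x‖|}.indicator (fun _ => 1) x := by
    intro x
    refine (norm_indicator_le_norm_self (fun x => 1 - ∑ i, f i x) x).trans ?_
    by_cases hx : x ∈ Metric.cthickening η boundaryH
    · rw [hsum x hx, sub_self, norm_zero]
      exact indicator_nonneg (fun _ _ => zero_le_one) _
    · have hx' : x ∈ {x : K3 | η ≤ |1 - ‖x‖|} := le_abs_one_sub_norm_of_notMem_cthickening hx
      rw [indicator_of_mem hx', Real.norm_eq_abs, abs_le]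
      constructor <;> linarith [hsum1 x, hsum0 x]
  have hS : MeasurableSet {x : K3 | η ≤ |1 - ‖x‖|} := measurableSet_le (by fun_prop) (by fun_prop)
  have hfar : HasInvariantLimit (D.indicator fun x => 1 - ∑ i, f i x) := by
    refine .of_integrable hm ⟨1, fun x => (hbd x).trans ?_⟩ ?_
    · exact indicator_le_self' (fun _ _ => zero_le_one) x
    · refine ((integrable_indicator_iff hS).2 (integrableOn_inv_sq_one_sub hη)).mono'
        ((hm.abs.div (by fun_prop)).aestronglyMeasurable) (.of_forall fun x => ?_)
      rw [Real.norm_eq_abs, abs_of_nonneg (by positivity), div_eq_mul_inv]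
      refine (mul_le_mul_of_nonneg_right (hbd x) (by positivity)).trans (le_of_eq ?_)
      by_cases hx : x ∈ {x : K3 | η ≤ |1 - ‖x‖|}
      · rw [indicator_of_mem hx, indicator_of_mem hx, one_mul]
      · rw [indicator_of_notMem hx, indicator_of_notMem hx, zero_mul]
  have hadd := hloc.add hfar
  convert! hadd using 1
  ext1 x
  by_cases hx : x ∈ D
  · simp [indicator_of_mem hx]
  · simp [indicator_of_notMem hx]

theorem integral_indicator_mul_pullDensity {D : Set K3} (hD : MeasurableSet D)
    (g : Minkowski ≃ₗ[ℝ] Minkowski) (ε : ℝ) :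
    ∫ x, ((D.indicator (fun _ => 1) x : ℝ) : ℂ) * pullDensity g ε x =
      ∫ x in D, pullDensity g ε x := by
  rw [← integral_indicator hD]
  congr 1
  ext1 x
  by_cases hx : x ∈ D
  · simp [indicator_of_mem hx]
  · simp [indicator_of_notMem hx]

theorem integrable_volDensity {ε : ℝ} (hε : 0 < ε) : Integrable (volDensity ε) := by
  have h := integrable_pullDensity (LinearEquiv.refl ℝ Minkowski) hε
  rwa [funext (pullDensity_refl ε)] at h

theorem hasVolume_of_tendsto {U : Set ExtSpace} {v : ℂ}
    (h : Tendsto (fun ε : ℝ => ∫ x in affinePart U, volDensity ε x) (𝓝[>] 0) (𝓝 v)) :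
    HasVolume U v :=
  ⟨fun _ hε => (integrable_volDensity hε).integrableOn, h⟩

/-- The change of variables turns the integrals for gU into integrals over U against the form pulled
back by g; the common limit is then read off at the identity and at g. -/
theorem exists_hasVolume_act {α : ℝ≥0} (hα : 0 < α) {U : Set ExtSpace}
    (hU : MeasurableSet (affinePart U)) (hUα : IsC1HolderTransversal α (affinePart U))
    {g : Minkowski ≃ₗ[ℝ] Minkowski} (hg : IsLorentz g) :
    ∃ v : ℂ, HasVolume U v ∧ HasVolume (act g U) v := by
  have hloc : ∀ p ∈ boundaryH, IsLocallyInvariant (affinePart U) p := by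
    intro p hp
    have hp1 : ‖p‖ = 1 := mem_sphere_zero_iff_norm.1 hp
    by_cases hpf : p ∈ frontier (affinePart U)
    · obtain ⟨V, hV, hpV, f, hf, hfr, htr⟩ := hUα p ⟨hpf, hp⟩
      have hfp : f p = 0 := by
        have : p ∈ frontier (affinePart U) ∩ V := ⟨hpf, hpV⟩
        rw [hfr] at this
        exact this.2
      exact isLocallyInvariant_of_mem_frontier hα hU hp1 hV hpV hf hfr hfp
        (htr p ⟨hpV, hp⟩ hfp)
    · exact isLocallyInvariant_of_notMem_frontier hU hp1 hpf
  obtain ⟨-, -, v, hv⟩ := hasInvariantLimit_indicator hU hloc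
  simp only [integral_indicator_mul_pullDensity hU] at hv
  refine ⟨v, hasVolume_of_tendsto ?_, hasVolume_of_tendsto ?_⟩
  · have h := hv _ IsLorentz.refl
    simpa only [pullDensity_refl] using h
  · simpa only [setIntegral_affinePart_act hg hU] using hv g hg

end ExtendedHyperbolic

end

theorem mainTheorem4 (α : ℝ≥0) (hα0 : 0 < α) (hα1 : α ≤ 1)
    (U : Set ExtendedHyperbolic.ExtSpace)
    (hU : MeasurableSet (ExtendedHyperbolic.affinePart U))
    (hUα : ExtendedHyperbolic.IsC1HolderTransversal α (ExtendedHyperbolic.affinePart U))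
    (g : ExtendedHyperbolic.Minkowski ≃ₗ[ℝ] ExtendedHyperbolic.Minkowski)
    (hg : ExtendedHyperbolic.IsLorentz g) :
    ∃ v : ℂ, ExtendedHyperbolic.HasVolume U v ∧
      ExtendedHyperbolic.HasVolume (ExtendedHyperbolic.act g U) v :=
  ExtendedHyperbolic.exists_hasVolume_act hα0 hU hUα hg
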